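/- **Setting.** Point sets are finite multisets in $\mathbb{R}^d$, with the Euclidean norm. For a nonempty finite multiset $S'$ in $\mathbb{R}^d$ and $\mu\in\mathbb{R}^d$ write $\mu_{S'}=\frac1{|S'|}\sum_{x\in S'}x$ and $\overline\Sigma_{S'}=\frac1{|S'|}\sum_{x\in S'}(x-\mu)(x-\mu)^T$. For $0<\eta<1/2$, $\delta\ge\eta$ and $\sigma>0$, a multiset $S$ is $(\eta,\delta)$-stable with respect to $\mu$ and $\sigma^2$ if every $S'\subseteq S$ with $|S'|\ge(1-\eta)|S|$ satisfies $\|\mu_{S'}-\mu\|\le\sigma\delta$ and $\|\overline\Sigma_{S'}-\sigma^2I\|\le\sigma^2\delta^2/\eta$ (spectral norm). A multiset $T$ is an $\epsilon$-corrupted version of $S$ if it is obtained from $S$ by replacing at most $\epsilon|S|$ of its points by arbitrary points, so $|T|=|S|$. **Theorem.** There are absolute constants $C_0,K>0$ and a single deterministic algorithm with the following properties. The input of the algorithm is $(T,\epsilon)$, where $T$ is a multiset of $n$ points of $\mathbb{R}^d$ ($n$ and $d$ arbitrary) and $\epsilon\in\mathbb{R}$; neither $\sigma$ nor $\delta$ is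 given to it. On every input it halts after a number of steps bounded by a fixed polynomial in $n$ and $d$, where a step is an exact arithmetic operation or comparison of real numbers, or an elementary operation on integer counters and addresses (real RAM without rounding operations). Its output is a vector $\widehat\mu\in\mathbb{R}^d$ such that, whenever $C\ge C_0$, $\sigma>0$, and $T$ is an $\epsilon$-corrupted version of a nonempty multiset $S$ that is $(C\epsilon,\delta)$-stable with respect to $\mu_S$ and $\sigma^2$, $$\|\mu_S-\widehat\mu\|\le K\,\sigma\,\delta .$$ -/

import Mathlib

/-! ### Point sets, stability, corruption -/

/-- `ℝ^d` with the Euclidean norm. -/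
abbrev RVec (d : ℕ) : Type := EuclideanSpace ℝ (Fin d)

/-- A multiset of `n` points of `ℝ^d`, listed as `x 0, …, x (n-1)` (repetitions allowed).
Its sub-multisets are given by the sets of indices. -/
abbrev Points (n d : ℕ) : Type := Fin n → RVec d

/-- The mean of the points with index in `I`, under the uniform distribution on `I`. -/
noncomputable def subMean {n d : ℕ} (x : Points n d) (I : Finset (Fin n)) : RVec d :=
  (I.card : ℝ)⁻¹ • ∑ i ∈ I, x i

/-- The second moment matrix, centered at `μ`, of the points with index in `I`:
`(1/|I|) ∑ (x - μ) (x - μ)ᵀ`. -/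
noncomputable def subSecondMoment {n d : ℕ} (x : Points n d) (μ : RVec d)
    (I : Finset (Fin n)) : Matrix (Fin d) (Fin d) ℝ :=
  (I.card : ℝ)⁻¹ • ∑ i ∈ I, Matrix.vecMulVec (x i - μ).ofLp (x i - μ).ofLp

/-- The spectral norm (operator norm with respect to the Euclidean norm) of a square matrix. -/
noncomputable def matSpectralNorm {d : ℕ} (M : Matrix (Fin d) (Fin d) ℝ) : ℝ :=
  ‖Matrix.toEuclideanCLM (n := Fin d) (𝕜 := ℝ) M‖

/-- The multiset `x` is `(ε, δ)`-stable with respect to `μ` and `σ²`. -/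
structure IsStable {n d : ℕ} (ε δ : ℝ) (x : Points n d) (μ : RVec d) (σ : ℝ) : Prop where
  eps_pos : 0 < ε
  eps_lt : ε < 1 / 2
  eps_le : ε ≤ δ
  mean_close : ∀ I : Finset (Fin n), (1 - ε) * (n : ℝ) ≤ (I.card : ℝ) →
    ‖subMean x I - μ‖ ≤ σ * δ
  secondMoment_close : ∀ I : Finset (Fin n), (1 - ε) * (n : ℝ) ≤ (I.card : ℝ) →
    matSpectralNorm (subSecondMoment x μ I - σ ^ 2 • (1 : Matrix (Fin d) (Fin d) ℝ))
      ≤ σ ^ 2 * δ ^ 2 / ε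

/-- `y` is an `ε`-corrupted version of `x`: it arises by replacing at most `ε n` of the `n`
points by arbitrary points. -/
def IsCorruption {n d : ℕ} (ε : ℝ) (x y : Points n d) : Prop :=
  ({i : Fin n | y i ≠ x i}.ncard : ℝ) ≤ ε * n

/-! ### A real RAM with a step count

Programs are imperative programs over integer registers and two-dimensional arrays of real
numbers. Reals are stored exactly; the operations are `+`, `-`, `*`, `/` and comparison, at unit
cost. There is no rounding operation and no conversion between reals and integers, and the only
literals are rational. Integer registers, used for counting and addressing, admit only addition,
(truncated) subtraction and comparison. -/

namespace RealRAM

/-- A memory state: integer register `r` holds `nat r`, and entry `(i, j)` of array `a` holds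
`real a i j`. -/
structure Store where
  nat : ℕ → ℕ
  real : ℕ → ℕ → ℕ → ℝ

/-- Integer expressions. -/
inductive NExp : Type
  | lit (k : ℕ)
  | reg (r : ℕ)
  | add (e f : NExp)
  | sub (e f : NExp)

namespace NExp

def eval (s : Store) : NExp → ℕ
  | lit k => k
  | reg r => s.nat r
  | add e f => e.eval s + f.eval s
  | sub e f => e.eval s - f.eval s

/-- Number of unit-cost operations in an evaluation. -/
def cost : NExp → ℕ
  | lit _ => 1
  | reg _ => 1
  | add e f => e.cost + f.cost + 1
  | sub e f => e.cost + f.cost + 1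

end NExp

/-- Real expressions; `get a i j` reads entry `(i, j)` of array `a`. -/
inductive RExp : Type
  | lit (q : ℚ)
  | get (a : ℕ) (i j : NExp)
  | add (e f : RExp)
  | sub (e f : RExp)
  | mul (e f : RExp)
  | div (e f : RExp)

namespace RExp

/-- The value of a real expression; division by zero yields zero. -/
noncomputable def eval (s : Store) : RExp → ℝ
  | lit q => (q : ℝ)
  | get a i j => s.real a (i.eval s) (j.eval s)
  | add e f => e.eval s + f.eval s
  | sub e f => e.eval s - f.eval s
  | mul e f => e.eval s * f.eval s
  | div e f => e.eval s / f.eval s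

/-- Number of unit-cost operations in an evaluation. -/
def cost : RExp → ℕ
  | lit _ => 1
  | get _ i j => i.cost + j.cost + 1
  | add e f => e.cost + f.cost + 1
  | sub e f => e.cost + f.cost + 1
  | mul e f => e.cost + f.cost + 1
  | div e f => e.cost + f.cost + 1

end RExp

/-- Tests. -/
inductive Test : Type
  | natLe (e f : NExp)
  | realLe (e f : RExp)
  | not (b : Test)
  | and (b c : Test)

namespace Test

def Holds (s : Store) : Test → Prop
  | natLe e f => e.eval s ≤ f.eval s
  | realLe e f => e.eval s ≤ f.eval s
  | not b => ¬ b.Holds s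
  | and b c => b.Holds s ∧ c.Holds s

/-- Number of unit-cost operations in an evaluation. -/
def cost : Test → ℕ
  | natLe e f => e.cost + f.cost + 1
  | realLe e f => e.cost + f.cost + 1
  | not b => b.cost + 1
  | and b c => b.cost + c.cost + 1

end Test

/-- Programs: integer assignment, assignment to an array entry, sequencing, conditional, and
while-loop. -/
inductive Prog : Type
  | skip
  | setNat (r : ℕ) (e : NExp)
  | setReal (a : ℕ) (i j : NExp) (e : RExp)
  | seq (P Q : Prog)
  | cond (b : Test) (P Q : Prog)
  | loop (b : Test) (P : Prog)

namespace Store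

def updNat (s : Store) (r k : ℕ) : Store :=
  { s with nat := fun r' => if r' = r then k else s.nat r' }

noncomputable def updReal (s : Store) (a i j : ℕ) (v : ℝ) : Store :=
  { s with real := fun a' i' j' => if a' = a ∧ i' = i ∧ j' = j then v else s.real a' i' j' }

end Store

/-- `Exec P s t s'`: started in the state `s`, the program `P` halts after exactly `t` steps in
the state `s'`. -/
inductive Exec : Prog → Store → ℕ → Store → Prop
  | skip (s : Store) : Exec Prog.skip s 1 s
  | setNat (r : ℕ) (e : NExp) (s : Store) :
      Exec (Prog.setNat r e) s (e.cost + 1) (s.updNat r (e.eval s))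
  | setReal (a : ℕ) (i j : NExp) (e : RExp) (s : Store) :
      Exec (Prog.setReal a i j e) s (i.cost + j.cost + e.cost + 1)
        (s.updReal a (i.eval s) (j.eval s) (e.eval s))
  | seq {P Q : Prog} {s s₁ s₂ : Store} {t₁ t₂ : ℕ} :
      Exec P s t₁ s₁ → Exec Q s₁ t₂ s₂ → Exec (Prog.seq P Q) s (t₁ + t₂) s₂
  | condTrue {b : Test} {P Q : Prog} {s s₁ : Store} {t : ℕ} :
      b.Holds s → Exec P s t s₁ → Exec (Prog.cond b P Q) s (b.cost + 1 + t) s₁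
  | condFalse {b : Test} {P Q : Prog} {s s₁ : Store} {t : ℕ} :
      ¬ b.Holds s → Exec Q s t s₁ → Exec (Prog.cond b P Q) s (b.cost + 1 + t) s₁
  | loopDone {b : Test} {P : Prog} {s : Store} :
      ¬ b.Holds s → Exec (Prog.loop b P) s (b.cost + 1) s
  | loopStep {b : Test} {P : Prog} {s s₁ s₂ : Store} {t₁ t₂ : ℕ} :
      b.Holds s → Exec P s t₁ s₁ → Exec (Prog.loop b P) s₁ t₂ s₂ →
        Exec (Prog.loop b P) s (b.cost + 1 + t₁ + t₂) s₂

/-- The machine is deterministic. -/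
theorem Exec.unique {P : Prog} {s s₁ s₂ : Store} {t₁ t₂ : ℕ}
    (h₁ : Exec P s t₁ s₁) (h₂ : Exec P s t₂ s₂) : t₁ = t₂ ∧ s₁ = s₂ := by
  induction h₁ generalizing t₂ s₂ with
  | skip s => cases h₂; exact ⟨rfl, rfl⟩
  | setNat r e s => cases h₂; exact ⟨rfl, rfl⟩
  | setReal a i j e s => cases h₂; exact ⟨rfl, rfl⟩
  | seq _ _ ih₁ ih₂ =>
    cases h₂ with
    | seq k₁ k₂ =>
      obtain ⟨rfl, rfl⟩ := ih₁ k₁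
      obtain ⟨rfl, rfl⟩ := ih₂ k₂
      exact ⟨rfl, rfl⟩
  | condTrue hb _ ih =>
    cases h₂ with
    | condTrue _ k => obtain ⟨rfl, rfl⟩ := ih k; exact ⟨rfl, rfl⟩
    | condFalse hb' _ => exact absurd hb hb'
  | condFalse hb _ ih =>
    cases h₂ with
    | condTrue hb' _ => exact absurd hb' hb
    | condFalse _ k => obtain ⟨rfl, rfl⟩ := ih k; exact ⟨rfl, rfl⟩
  | loopDone hb =>
    cases h₂ with
    | loopDone _ => exact ⟨rfl, rfl⟩
    | loopStep hb' _ _ => exact absurd hb' hb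
  | loopStep hb _ _ ih₁ ih₂ =>
    cases h₂ with
    | loopDone hb' => exact absurd hb hb'
    | loopStep _ k₁ k₂ =>
      obtain ⟨rfl, rfl⟩ := ih₁ k₁
      obtain ⟨rfl, rfl⟩ := ih₂ k₂
      exact ⟨rfl, rfl⟩

/-- The initial state on input `(y, ε)`: registers `0` and `1` hold `n` and `d`, array `0` holds
the `n × d` table of coordinates of the points, entry `(0, 0)` of array `1` holds `ε`, and
everything else is zero. -/
noncomputable def inputStore {n d : ℕ} (y : Points n d) (ε : ℝ) : Store where
  nat r := if r = 0 then n else if r = 1 then d else 0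
  real a i j :=
    if a = 0 then (if h : i < n ∧ j < d then y ⟨i, h.1⟩ ⟨j, h.2⟩ else 0)
    else if a = 1 ∧ i = 0 ∧ j = 0 then ε else 0

/-- The output: the first `d` entries of row `0` of array `2`. -/
noncomputable def outputVec (d : ℕ) (s : Store) : RVec d :=
  WithLp.toLp 2 fun j => s.real 2 0 j

end RealRAM

/-- A rule that assigns a vector in `ℝ^d` to every `n`, `d`, every `n` points in `ℝ^d` and
every real parameter `ε`. -/
abbrev Estimator : Type := ∀ n d : ℕ, Points n d → ℝ → RVec d

/-- The estimator is computed by one program, the same for all inputs, which halts on every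
input `(y, ε)` after a number of steps polynomial in `n` and `d`. -/
def Estimator.IsPolyTime (F : Estimator) : Prop :=
  ∃ (P : RealRAM.Prog) (p : Polynomial ℕ), ∀ (n d : ℕ) (y : Points n d) (ε : ℝ),
    ∃ (t : ℕ) (s : RealRAM.Store), RealRAM.Exec P (RealRAM.inputStore y ε) t s ∧
      t ≤ p.eval (n + d) ∧ RealRAM.outputVec d s = F n d y ε

/-! The estimator is a weighted filter. All weights start at one and are only ever lowered; the
output is the weighted mean. Put s = σ² and Δ = σ²δ²/(Cε). Stability says that in every direction
the clean second moment is s ± Δ per point, and that any fraction 3ε of the clean points contributes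
at most 3nΔ (`IsStable.robustData`). If the weights removed total at most 2εn and the weighted
second moment is at most n(s + Λ) in every direction, then the corrupted points have little second
moment left to themselves. By Cauchy–Schwarz they cannot move the mean by more than the square root
of ε(112Δ + 8Λ) (`RobustData.norm_wmean_sub_sq_le`). With Λ = O(Δ) the error is O(σδ/√C).

A real RAM cannot produce exact eigenvectors, so outliers are scored by the quadratic form of the
scatter matrix M raised to the power m = 2^(n+d), reached by n + d squarings. The weighted scores
sum to tr M^(m+1), and tr M^(m+1) / tr M^m is the largest eigenvalue up to a factor (n+1)/n
(`max_mul_sum_pow_le`). Consider the ⌊εn⌋ points of largest weighted score. If good points carry at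
least half of their score, the total score is about what clean data would give, so every eigenvalue
is at most n(s + 42Δ) (`RobustData.wvar_le_of_top_good`). Otherwise, lowering their weights in
proportion to the scores removes more weight from bad points than from good ones and annihilates
some weight, so at most n such steps can occur (`RobustData.wvar_le_or_filterStep`).

Since σ and δ are unknown, it cannot be tested when to stop. All n steps are run, and a step that
would bring the removed weight above 2εn is undone. Later steps do no harm, because lowering weights
lowers the unnormalised second moment (`wvar_mono`). Floors are avoided by comparing ranks, computed
as real numbers, with εn. The machine part shows that nested counted loops of size at most n + d + 1
implement these formulas in polynomially many steps. -/

/-! ### Counted loops on the real RAM -/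

namespace RealRAM

/-- The contents of the real arrays. -/
abbrev Mem : Type := ℕ → ℕ → ℕ → ℝ

/-- `for r in 0, …, b - 1 do P`. -/
def forLoop (r : ℕ) (b : NExp) (P : Prog) : Prog :=
  .seq (.setNat r (.lit 0))
    (.loop (.natLe (.add (.reg r) (.lit 1)) b) (.seq P (.setNat r (.add (.reg r) (.lit 1)))))

theorem updNat_nat_self (s : Store) (r k : ℕ) : (s.updNat r k).nat r = k := by
  simp [Store.updNat]

theorem updNat_nat_of_ne (s : Store) {r r' : ℕ} (k : ℕ) (h : r' ≠ r) :
    (s.updNat r k).nat r' = s.nat r' := by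
  simp [Store.updNat, h]

theorem updNat_real (s : Store) (r k : ℕ) : (s.updNat r k).real = s.real := rfl

/-- Induction on the number m of rounds left. Tests offer only ≤, so r < b is written r + 1 ≤ b. The
bound b is evaluated anew in each round, so the invariant has to pin its value. -/
theorem exec_loop_of_invariant {r : ℕ} {b : NExp} {P : Prog} {N T : ℕ} (Inv : ℕ → Store → Prop)
    (hb : ∀ k s, Inv k s → s.nat r = k ∧ b.eval s = N)
    (hstep : ∀ k s, k < N → Inv k s →
      ∃ t s', Exec P s t s' ∧ t ≤ T ∧ s'.nat r = k ∧ Inv (k + 1) (s'.updNat r (k + 1)))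
    (m : ℕ) : ∀ k s, k + m = N → Inv k s →
      ∃ t s', Exec (.loop (.natLe (.add (.reg r) (.lit 1)) b)
          (.seq P (.setNat r (.add (.reg r) (.lit 1))))) s t s' ∧
        t ≤ (m + 1) * (T + b.cost + 9) ∧ Inv N s' := by
  induction m with
  | zero =>
    intro k s hk hI
    obtain ⟨h1, h2⟩ := hb k s hI
    refine ⟨_, s, Exec.loopDone ?_, ?_, ?_⟩
    · simp only [Test.Holds, NExp.eval, h1, h2]; omega
    · simp only [Test.cost, NExp.cost]; omega
    · have : k = N := by omega
      exact this ▸ hI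
  | succ m ih =>
    intro k s hk hI
    obtain ⟨h1, h2⟩ := hb k s hI
    obtain ⟨t, s', hP, ht, hr, hI'⟩ := hstep k s (by omega) hI
    obtain ⟨t₂, s₂, hL, ht₂, hI₂⟩ := ih (k + 1) _ (by omega) hI'
    have hset := Exec.setNat r (.add (.reg r) (.lit 1)) s'
    have hev : (NExp.add (.reg r) (.lit 1)).eval s' = k + 1 := by simp [NExp.eval, hr]
    rw [hev] at hset
    refine ⟨_, s₂, Exec.loopStep ?_ (Exec.seq hP hset) hL, ?_, hI₂⟩
    · simp only [Test.Holds, NExp.eval, h1, h2]; omega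
    · simp only [Test.cost, NExp.cost]
      have : (m + 1 + 1) * (T + b.cost + 9) = (m + 1) * (T + b.cost + 9) + (T + b.cost + 9) := by
        ring
      omega

theorem exec_forLoop {r : ℕ} {b : NExp} {P : Prog} {N T : ℕ} (Inv : ℕ → Store → Prop)
    (hb : ∀ k s, Inv k s → s.nat r = k ∧ b.eval s = N)
    (hstep : ∀ k s, k < N → Inv k s →
      ∃ t s', Exec P s t s' ∧ t ≤ T ∧ s'.nat r = k ∧ Inv (k + 1) (s'.updNat r (k + 1)))
    (s : Store) (h0 : Inv 0 (s.updNat r 0)) :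
    ∃ t s', Exec (forLoop r b P) s t s' ∧ t ≤ 2 + (N + 1) * (T + b.cost + 9) ∧ Inv N s' := by
  obtain ⟨t, s', h, ht, hI⟩ := exec_loop_of_invariant Inv hb hstep N 0 _ (by omega) h0
  exact ⟨_, s', Exec.seq (Exec.setNat r (.lit 0) s) h,
    by simp only [NExp.cost]; omega, hI⟩

/-- `P` transforms the real arrays by `f`, which depends on the values `n` and `d` of the first
two registers, in a number of steps polynomial in `n + d`; it touches no register outside
`[2, D)`. -/
def Computes (D : ℕ) (P : Prog) (f : ℕ → ℕ → Mem → Mem) : Prop :=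
  ∃ p : Polynomial ℕ, ∀ s : Store, ∃ t s', Exec P s t s' ∧
    t ≤ p.eval (s.nat 0 + s.nat 1) ∧ s'.real = f (s.nat 0) (s.nat 1) s.real ∧
    ∀ r, r < 2 ∨ D ≤ r → s'.nat r = s.nat r

theorem Computes.mono {D D' : ℕ} {P : Prog} {f : ℕ → ℕ → Mem → Mem} (h : Computes D P f)
    (hD : D ≤ D') : Computes D' P f := by
  obtain ⟨p, h⟩ := h
  refine ⟨p, fun s => ?_⟩
  obtain ⟨t, s', h1, h2, h3, h4⟩ := h s
  exact ⟨t, s', h1, h2, h3, fun r hr => h4 r (by omega)⟩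

theorem Computes.seq {D : ℕ} {P Q : Prog} {f g : ℕ → ℕ → Mem → Mem} (hP : Computes D P f)
    (hQ : Computes D Q g) : Computes D (.seq P Q) (fun n d R => g n d (f n d R)) := by
  obtain ⟨p, hP⟩ := hP
  obtain ⟨q, hQ⟩ := hQ
  refine ⟨p + q, fun s => ?_⟩
  obtain ⟨t, s', h1, h2, h3, h4⟩ := hP s
  obtain ⟨t', s'', k1, k2, k3, k4⟩ := hQ s'
  have e0 := h4 0 (by omega)
  have e1 := h4 1 (by omega)
  rw [e0, e1] at k2 k3
  refine ⟨_, s'', Exec.seq h1 k1, ?_, by rw [k3, h3], fun r hr => (k4 r hr).trans (h4 r hr)⟩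
  rw [Polynomial.eval_add]; omega

/-- `b` evaluates to `N n d`, where `n` and `d` are the values of the first two registers. -/
def IsSize (b : NExp) (N : ℕ → ℕ → ℕ) : Prop :=
  (∀ s, b.eval s = N (s.nat 0) (s.nat 1)) ∧ ∀ n d, N n d ≤ n + d + 1

theorem isSize_one : IsSize (.lit 1) (fun _ _ => 1) := ⟨fun _ => rfl, fun _ _ => by dsimp only; omega⟩

theorem isSize_points : IsSize (.reg 0) (fun n _ => n) := ⟨fun _ => rfl, fun _ _ => by dsimp only; omega⟩

theorem isSize_dim : IsSize (.reg 1) (fun _ d => d) := ⟨fun _ => rfl, fun _ _ => by dsimp only; omega⟩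

theorem isSize_add : IsSize (.add (.reg 0) (.reg 1)) (fun n d => n + d) :=
  ⟨fun _ => rfl, fun _ _ => by dsimp only; omega⟩

/-- The counter lives in register `D`, just outside the range that the body may touch, so nested
loops do not interfere. -/
theorem Computes.repeat {D : ℕ} {b : NExp} {N : ℕ → ℕ → ℕ} {P : Prog} {f : ℕ → ℕ → Mem → Mem}
    (hD : 2 ≤ D) (hP : Computes D P f) (hb : IsSize b N) :
    Computes (D + 1) (forLoop D b P) (fun n d => (f n d)^[N n d]) := by
  obtain ⟨p, hP⟩ := hP
  refine ⟨2 + (Polynomial.X + 2) * (p + Polynomial.C (b.cost + 9)), fun s => ?_⟩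
  set n := s.nat 0 with hn
  set d := s.nat 1 with hd
  obtain ⟨t, s', h1, h2, h3, h4, h5⟩ := exec_forLoop (r := D) (b := b) (P := P) (N := N n d)
    (T := p.eval (n + d))
    (fun k s' => s'.nat D = k ∧ s'.real = (f n d)^[k] s.real ∧
      ∀ r, r < 2 ∨ D + 1 ≤ r → s'.nat r = s.nat r)
    (by
      rintro k s' ⟨h1, h2, h3⟩
      refine ⟨h1, ?_⟩
      rw [hb.1, h3 0 (by omega), h3 1 (by omega)])
    (by
      rintro k s' - ⟨h1, h2, h3⟩
      obtain ⟨t, s'', k1, k2, k3, k4⟩ := hP s'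
      rw [h3 0 (by omega), h3 1 (by omega)] at k2 k3
      refine ⟨t, s'', k1, k2, (k4 D (by omega)).trans h1, updNat_nat_self _ _ _, ?_, ?_⟩
      · rw [updNat_real, k3, h2, Function.iterate_succ_apply']
      · intro r hr
        rw [updNat_nat_of_ne _ _ (by omega), k4 r (by omega), h3 r hr])
    s ⟨updNat_nat_self _ _ _, rfl, fun r hr => updNat_nat_of_ne _ _ (by omega)⟩
  refine ⟨t, s', h1, h2.trans ?_, h4, h5⟩
  have := hb.2 n d
  simp only [Polynomial.eval_add, Polynomial.eval_mul, Polynomial.eval_X, Polynomial.eval_C,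
    Polynomial.eval_ofNat]
  have h : (N n d + 1) * (p.eval (n + d) + b.cost + 9) ≤
      (n + d + 2) * (p.eval (n + d) + (b.cost + 9)) :=
    Nat.mul_le_mul (by omega) (by omega)
  omega

/-! ### Tabulating an array by folds -/

/-- `f (l - 1) (… (f 1 (f 0 0)))`. -/
noncomputable def foldVal (f : ℕ → ℝ → ℝ) : ℕ → ℝ
  | 0 => 0
  | l + 1 => f l (foldVal f l)

theorem foldVal_add (f : ℕ → ℝ) (l : ℕ) :
    foldVal (fun k acc => acc + f k) l = ∑ k ∈ Finset.range l, f k := by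
  induction l with
  | zero => rfl
  | succ l ih => rw [Finset.sum_range_succ, ← ih]; rfl

open Classical in
/-- `x` if `p` holds, and `y` otherwise. -/
noncomputable def pick (p : Prop) (x y : ℝ) : ℝ := if p then x else y

theorem pick_eq_ite (p : Prop) [Decidable p] (x y : ℝ) : pick p x y = if p then x else y := by
  rw [pick]; congr

/-- Overwrite the entries `(i, j)`, `i < N`, `j < M`, of the array `a`. -/
noncomputable def overwrite (a N M : ℕ) (v : ℕ → ℕ → ℝ) (R : Mem) : Mem :=
  fun a' i j => if a' = a ∧ i < N ∧ j < M then v i j else R a' i j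

theorem overwrite_of_ne {a a' N M : ℕ} {v : ℕ → ℕ → ℝ} {R : Mem} (h : a' ≠ a) :
    overwrite a N M v R a' = R a' := by
  funext i j; simp [overwrite, h]

theorem overwrite_self {a N M i j : ℕ} {v : ℕ → ℕ → ℝ} {R : Mem} (hi : i < N) (hj : j < M) :
    overwrite a N M v R a i j = v i j := by
  simp [overwrite, hi, hj]

/-- For `i < N`, `j < M`: set entry `(i, j)` of `a` to zero, then, for `l < L`, replace it by the
value of `e₁` or `e₂`, according to `b`. The loop variables `i`, `j`, `l` are in the registers
`2`, `3`, `4`. -/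
def tabulate (a : ℕ) (N M L : NExp) (b : Test) (e₁ e₂ : RExp) : Prog :=
  forLoop 2 N (forLoop 3 M (.seq (.setReal a (.reg 2) (.reg 3) (.lit 0))
    (forLoop 4 L (.cond b (.setReal a (.reg 2) (.reg 3) e₁) (.setReal a (.reg 2) (.reg 3) e₂)))))

/-- The store agrees with `s` on all registers but the loop variables, and its arrays are `R`. -/
def AgreesWith (s s' : Store) (R : Mem) : Prop :=
  (∀ r, r < 2 ∨ 5 ≤ r → s'.nat r = s.nat r) ∧ s'.real = R

theorem AgreesWith.updNat {s s' : Store} {R : Mem} (h : AgreesWith s s' R) {r : ℕ} (k : ℕ)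
    (hr : 2 ≤ r) (hr' : r < 5) : AgreesWith s (s'.updNat r k) R :=
  ⟨fun q hq => (updNat_nat_of_ne _ _ (by omega)).trans (h.1 q hq), h.2⟩

theorem AgreesWith.size {s s' : Store} {R : Mem} (h : AgreesWith s s' R) {b : NExp}
    {N : ℕ → ℕ → ℕ} (hb : IsSize b N) : b.eval s' = N (s.nat 0) (s.nat 1) := by
  rw [hb.1, h.1 0 (by omega), h.1 1 (by omega)]

/-- By `hcongr` the body reads array `a` only through the accumulator in the current cell. Cells
already overwritten therefore cannot influence later ones, and every entry is a function of the
initial memory. -/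
theorem computes_tabulate (a : ℕ) {N M L : NExp} {N' M' L' : ℕ → ℕ → ℕ} {b : Test} {e₁ e₂ : RExp}
    (hN : IsSize N N') (hM : IsSize M M') (hL : IsSize L L')
    (step : Mem → ℕ → ℕ → ℕ → ℝ → ℝ)
    (hstep : ∀ s : Store, pick (b.Holds s) (e₁.eval s) (e₂.eval s) =
      step s.real (s.nat 2) (s.nat 3) (s.nat 4) (s.real a (s.nat 2) (s.nat 3)))
    (hcongr : ∀ R R' : Mem, (∀ a', a' ≠ a → R a' = R' a') → step R = step R') :
    Computes 5 (tabulate a N M L b e₁ e₂) (fun n d R =>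
      overwrite a (N' n d) (M' n d) (fun i j => foldVal (step R i j) (L' n d)) R) := by
  set c := b.cost + e₁.cost + e₂.cost + 10 with hc
  have key : ∀ s : Store, ∃ t s', Exec (tabulate a N M L b e₁ e₂) s t s' ∧
      t ≤ 2 + (N' (s.nat 0) (s.nat 1) + 1) * ((2 + (M' (s.nat 0) (s.nat 1) + 1) *
        ((10 + (2 + (L' (s.nat 0) (s.nat 1) + 1) * (c + L.cost + 9))) + M.cost + 9)) +
          N.cost + 9) ∧
      s'.nat 2 = N' (s.nat 0) (s.nat 1) ∧
      AgreesWith s s' (overwrite a (N' (s.nat 0) (s.nat 1)) (M' (s.nat 0) (s.nat 1))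
        (fun i j => foldVal (step s.real i j) (L' (s.nat 0) (s.nat 1))) s.real) := by
    intro s
    set n := s.nat 0 with hn
    set d := s.nat 1 with hd
    set R := s.real with hR
    set v : ℕ → ℕ → ℝ := fun i j => foldVal (step R i j) (L' n d) with hv
    refine exec_forLoop
      (fun i s' => s'.nat 2 = i ∧ AgreesWith s s' (overwrite a i (M' n d) v R))
      (fun i s' h => ⟨h.1, h.2.size hN⟩) ?_ s ⟨updNat_nat_self _ _ _, ?_⟩
    swap
    · refine AgreesWith.updNat ⟨fun _ _ => rfl, ?_⟩ _ (by omega) (by omega)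
      funext a' i j; simp [overwrite, hR]
    rintro i s₁ - ⟨hi, hs₁⟩
    -- Invariant of the middle loop: the rows before `i` are finished, and row `i` is filled up to
    -- column `j`. `Cell` below adds the partial fold at the current position.
    let Row : ℕ → Mem := fun j a' i' j' =>
      if a' = a ∧ (i' < i ∧ j' < M' n d ∨ i' = i ∧ j' < j) then v i' j' else R a' i' j'
    obtain ⟨t, s₂, h1, h2, h3, h4, h5⟩ := exec_forLoop (r := 3) (b := M) (N := M' n d)
      (T := 10 + (2 + (L' n d + 1) * (c + L.cost + 9)))
      (P := .seq (.setReal a (.reg 2) (.reg 3) (.lit 0))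
        (forLoop 4 L (.cond b (.setReal a (.reg 2) (.reg 3) e₁)
          (.setReal a (.reg 2) (.reg 3) e₂))))
      (fun j s' => s'.nat 3 = j ∧ s'.nat 2 = i ∧ AgreesWith s s' (Row j))
      (fun j s' h => ⟨h.1, h.2.2.size hM⟩) (by
        rintro j s₂ - ⟨hj, hi₂, hs₂⟩
        let Cell : ℕ → Mem := fun l a' i' j' =>
          if a' = a ∧ i' = i ∧ j' = j then foldVal (step R i j) l else Row j a' i' j'
        have hzero := Exec.setReal a (.reg 2) (.reg 3) (.lit 0) s₂
        simp only [NExp.eval, RExp.eval, hj, hi₂] at hzero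
        obtain ⟨t, s₃, h1, h2, h3, h4, h5, h6⟩ := exec_forLoop (r := 4) (b := L) (N := L' n d)
          (T := c)
          (P := .cond b (.setReal a (.reg 2) (.reg 3) e₁) (.setReal a (.reg 2) (.reg 3) e₂))
          (fun l s' => s'.nat 4 = l ∧ s'.nat 3 = j ∧ s'.nat 2 = i ∧ AgreesWith s s' (Cell l))
          (fun j s' h => ⟨h.1, h.2.2.2.size hL⟩) (by
            rintro l s₃ - ⟨hl, hj₃, hi₃, hs₃⟩
            have hst := hstep s₃
            have hRc : step s₃.real = step R := by
              apply hcongr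
              intro a' ha'
              funext i' j'
              rw [hs₃.2]
              simp [Cell, Row, ha']
            have hcell : s₃.real a i j = foldVal (step R i j) l := by
              rw [hs₃.2]; simp [Cell]
            rw [hi₃, hj₃, hl, hRc, hcell] at hst
            have hnew : AgreesWith s (s₃.updReal a i j (step R i j l (foldVal (step R i j) l)))
                (Cell (l + 1)) := by
              refine ⟨hs₃.1, ?_⟩
              funext a' i' j'
              simp only [Store.updReal, Cell, hs₃.2, foldVal]
              split_ifs <;> rfl
            by_cases hbs : b.Holds s₃
            · have he := Exec.condTrue (Q := .setReal a (.reg 2) (.reg 3) e₂) hbs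
                (Exec.setReal a (.reg 2) (.reg 3) e₁ s₃)
              rw [pick, if_pos hbs] at hst
              simp only [NExp.eval, hj₃, hi₃, hst] at he
              refine ⟨_, _, he, ?_, hl, updNat_nat_self _ _ _,
                hj₃, hi₃, hnew.updNat _ (by omega) (by omega)⟩
              simp only [NExp.cost]; omega
            · have he := Exec.condFalse (P := .setReal a (.reg 2) (.reg 3) e₁) hbs
                (Exec.setReal a (.reg 2) (.reg 3) e₂ s₃)
              rw [pick, if_neg hbs] at hst
              simp only [NExp.eval, hj₃, hi₃, hst] at he
              refine ⟨_, _, he, ?_, hl, updNat_nat_self _ _ _,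
                hj₃, hi₃, hnew.updNat _ (by omega) (by omega)⟩
              simp only [NExp.cost]; omega)
          (s₂.updReal a i j ((0 : ℚ) : ℝ))
          ⟨updNat_nat_self _ _ _, hj, hi₂, by
            refine AgreesWith.updNat (s' := s₂.updReal a i j ((0 : ℚ) : ℝ))
              ⟨hs₂.1, ?_⟩ _ (by omega) (by omega)
            funext a' i' j'
            simp only [Store.updReal, Cell, hs₂.2, foldVal, Rat.cast_zero]⟩
        refine ⟨_, s₃, Exec.seq hzero h1, ?_, h4, updNat_nat_self _ _ _, h5, ?_⟩
        · simp only [NExp.cost, RExp.cost]; omega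
        · refine AgreesWith.updNat ⟨h6.1, ?_⟩ _ (by omega) (by omega)
          rw [h6.2]
          funext a' i' j'
          simp only [Cell, Row]
          by_cases ha : a' = a
          · subst ha
            by_cases hii : i' = i
            · subst hii
              by_cases hjj : j' = j
              · subst hjj; simp [hv]
              · have : j' < j + 1 ↔ j' < j := by omega
                simp [hjj, this]
            · simp [hii]
          · simp [ha])
      s₁ ⟨updNat_nat_self _ _ _, hi, by
        refine AgreesWith.updNat ⟨hs₁.1, ?_⟩ _ (by omega) (by omega)
        rw [hs₁.2]; funext a' i' j'; simp [Row, overwrite]⟩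
    refine ⟨t, s₂, h1, h2, h4, updNat_nat_self _ _ _, ?_⟩
    refine AgreesWith.updNat ⟨h5.1, ?_⟩ _ (by omega) (by omega)
    rw [h5.2]
    funext a' i' j'
    have : (i' < i ∧ j' < M' n d ∨ i' = i ∧ j' < M' n d) ↔ (i' < i + 1 ∧ j' < M' n d) := by omega
    simp only [Row, overwrite, this]
  refine ⟨2 + (Polynomial.X + 2) * ((2 + (Polynomial.X + 2) *
        ((10 + (2 + (Polynomial.X + 2) * Polynomial.C (c + L.cost + 9))) +
          Polynomial.C M.cost + 9)) + Polynomial.C N.cost + 9), fun s => ?_⟩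
  obtain ⟨t, s', h1, h2, -, h4, h5⟩ := key s
  refine ⟨t, s', h1, h2.trans ?_, h5, h4⟩
  have bN : N' (s.nat 0) (s.nat 1) + 1 ≤ s.nat 0 + s.nat 1 + 2 := Nat.succ_le_succ (hN.2 _ _)
  have bM : M' (s.nat 0) (s.nat 1) + 1 ≤ s.nat 0 + s.nat 1 + 2 := Nat.succ_le_succ (hM.2 _ _)
  have bL : L' (s.nat 0) (s.nat 1) + 1 ≤ s.nat 0 + s.nat 1 + 2 := Nat.succ_le_succ (hL.2 _ _)
  simp only [Polynomial.eval_add, Polynomial.eval_mul, Polynomial.eval_X, Polynomial.eval_C,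
    Polynomial.eval_ofNat]
  generalize N' (s.nat 0) (s.nat 1) + 1 = x at *
  generalize M' (s.nat 0) (s.nat 1) + 1 = y at *
  generalize L' (s.nat 0) (s.nat 1) + 1 = z at *
  gcongr

end RealRAM

/-! ### Weighted means and second moments -/

section WeightedMoments

variable {n d : ℕ}

/-- The mean of the points `y i` with weights `w i`. -/
noncomputable def wmean (y : Points n d) (w : Fin n → ℝ) : RVec d :=
  (∑ i, w i)⁻¹ • ∑ i, w i • y i

/-- The unnormalised weighted second moment in direction `v`, centered at the weighted mean. -/
noncomputable def wvar (y : Points n d) (w : Fin n → ℝ) (v : RVec d) : ℝ :=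
  ∑ i, w i * inner ℝ v (y i - wmean y w) ^ 2

theorem sum_mul_inner_sub_wmean (y : Points n d) {w : Fin n → ℝ} (hw : ∑ i, w i ≠ 0)
    (v : RVec d) : ∑ i, w i * inner ℝ v (y i - wmean y w) = 0 := by
  have h : ∑ i, w i • (y i - wmean y w) = 0 := by
    simp only [smul_sub, Finset.sum_sub_distrib, ← Finset.sum_smul]
    rw [wmean, smul_smul, mul_inv_cancel₀ hw, one_smul, sub_self]
  have h2 := congrArg (fun z => inner ℝ v z) h
  simpa [inner_sum, inner_smul_right] using h2

/-- Expand about the weighted mean: the cross term vanishes, and moving the centre to `c` adds a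
nonnegative square times the total weight. -/
theorem wvar_le_sum (y : Points n d) {w : Fin n → ℝ} (hw : 0 < ∑ i, w i) (v c : RVec d) :
    wvar y w v ≤ ∑ i, w i * inner ℝ v (y i - c) ^ 2 := by
  set m := wmean y w
  have h := sum_mul_inner_sub_wmean y hw.ne' v
  have e : ∀ i, w i * inner ℝ v (y i - c) ^ 2 = w i * inner ℝ v (y i - m) ^ 2 +
      2 * inner ℝ v (m - c) * (w i * inner ℝ v (y i - m)) + w i * inner ℝ v (m - c) ^ 2 := by
    intro i
    have : inner ℝ v (y i - c) = inner ℝ v (y i - m) + inner ℝ v (m - c) := by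
      rw [← inner_add_right]; congr 1; abel
    rw [this]; ring
  simp only [e, Finset.sum_add_distrib, ← Finset.mul_sum, ← Finset.sum_mul]
  rw [h]
  have : 0 ≤ (∑ i, w i) * inner ℝ v (m - c) ^ 2 := by positivity
  simp only [wvar]
  linarith

/-- Lowering weights lowers the unnormalised second moment. -/
theorem wvar_mono (y : Points n d) {w w' : Fin n → ℝ} (hw : 0 < ∑ i, w' i) (h : ∀ i, w' i ≤ w i)
    (v : RVec d) : wvar y w' v ≤ wvar y w v :=
  (wvar_le_sum y hw v (wmean y w)).trans
    (Finset.sum_le_sum fun i _ => mul_le_mul_of_nonneg_right (h i) (sq_nonneg _))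

end WeightedMoments

/-! ### Largest values -/

theorem exists_top_finset {n : ℕ} (f : Fin n → ℝ) (K : ℕ) (hK : K ≤ n) :
    ∃ L : Finset (Fin n), L.card = K ∧ ∀ i ∈ L, ∀ j ∉ L, f j ≤ f i := by
  induction K with
  | zero => exact ⟨∅, rfl, by simp⟩
  | succ K ih =>
    obtain ⟨L, hL, htop⟩ := ih (by omega)
    have hne : Lᶜ.Nonempty := by
      rw [← Finset.card_pos, Finset.card_compl, Fintype.card_fin]; omega
    obtain ⟨m, hm, hmax⟩ := Finset.exists_max_image Lᶜ f hne
    rw [Finset.mem_compl] at hm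
    refine ⟨insert m L, by rw [Finset.card_insert_of_notMem hm, hL], ?_⟩
    intro i hi j hj
    rw [Finset.mem_insert, not_or] at hj
    rcases Finset.mem_insert.1 hi with rfl | hi
    · exact hmax j (Finset.mem_compl.2 hj.2)
    · exact htop i hi j hj.2

/-- A fractional selection of total weight at most `|L|` has at most the value of the set `L` of
the largest entries. -/
theorem sum_mul_le_sum_top {n : ℕ} {f u : Fin n → ℝ} {L : Finset (Fin n)}
    (hf : ∀ i, 0 ≤ f i) (hu : ∀ i, 0 ≤ u i) (hu1 : ∀ i, u i ≤ 1)
    (htop : ∀ i ∈ L, ∀ j ∉ L, f j ≤ f i) (hs : ∑ i, u i ≤ L.card) :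
    ∑ i, u i * f i ≤ ∑ i ∈ L, f i := by
  rcases L.eq_empty_or_nonempty with rfl | hne
  · simp only [Finset.card_empty, Nat.cast_zero] at hs
    have h0 := (Finset.sum_eq_zero_iff_of_nonneg fun i _ => hu i).1
      (le_antisymm hs (Finset.sum_nonneg fun i _ => hu i))
    rw [Finset.sum_empty, Finset.sum_eq_zero fun i hi => by rw [h0 i hi, zero_mul]]
  · obtain ⟨m, hm, hmin⟩ := Finset.exists_min_image L f hne
    -- The least value on `L` serves as a threshold: after subtracting it, terms in `L` are
    -- nonnegative and terms outside are nonpositive.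
    have h1 : ∑ i, u i * (f i - f m) ≤ ∑ i ∈ L, (f i - f m) := by
      rw [← Finset.sum_add_sum_compl L]
      have hin : ∑ i ∈ L, u i * (f i - f m) ≤ ∑ i ∈ L, (f i - f m) :=
        Finset.sum_le_sum fun i hi =>
          mul_le_of_le_one_left (sub_nonneg.2 (hmin i hi)) (hu1 i)
      have hout : ∑ i ∈ Lᶜ, u i * (f i - f m) ≤ 0 :=
        Finset.sum_nonpos fun i hi => mul_nonpos_of_nonneg_of_nonpos (hu i)
          (sub_nonpos.2 (htop m hm i (Finset.mem_compl.1 hi)))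
      linarith
    have h2 : ∑ i, u i * (f i - f m) = ∑ i, u i * f i - (∑ i, u i) * f m := by
      simp only [mul_sub, Finset.sum_sub_distrib, Finset.sum_mul]
    have h3 : ∑ i ∈ L, (f i - f m) = ∑ i ∈ L, f i - L.card * f m := by
      simp [Finset.sum_sub_distrib]
    nlinarith [mul_le_mul_of_nonneg_right hs (hf m)]

/-! ### The error of a weighted mean -/

/-- `y` differs from `x` only on `B`, and `x` has the second moments of a stable sample: in every
direction the second moment about `μ` is `s ± Δ`, and a fraction `3 ε` of the points contributes
at most `3 Δ`. -/
structure RobustData {n d : ℕ} (x y : Points n d) (B : Finset (Fin n)) (μ : RVec d)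
    (ε s Δ : ℝ) : Prop where
  agree : ∀ i ∉ B, y i = x i
  card_le : (B.card : ℝ) ≤ ε * n
  centered : ∑ i, (x i - μ) = 0
  eps_le : ε ≤ 1 / 2000
  one_le : 1 ≤ ε * n
  s_nonneg : 0 ≤ s
  s_mul_le : s * ε ≤ Δ
  moment_ge : ∀ v : RVec d, ‖v‖ = 1 → n * (s - Δ) ≤ ∑ i, inner ℝ v (x i - μ) ^ 2
  moment_le : ∀ v : RVec d, ‖v‖ = 1 → ∑ i, inner ℝ v (x i - μ) ^ 2 ≤ n * (s + Δ)
  tail_le : ∀ v : RVec d, ‖v‖ = 1 → ∀ u : Fin n → ℝ, (∀ i, 0 ≤ u i) → (∀ i, u i ≤ 1) →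
    ∑ i, u i ≤ 3 * (ε * n) → ∑ i, u i * inner ℝ v (x i - μ) ^ 2 ≤ 3 * n * Δ

namespace RobustData

variable {n d : ℕ} {x y : Points n d} {B : Finset (Fin n)} {μ : RVec d} {ε s Δ : ℝ}

theorem card_pos (h : RobustData x y B μ ε s Δ) : (0 : ℝ) < n := by
  rcases Nat.eq_zero_or_pos n with rfl | hn
  · have := h.one_le; norm_num at this
  · exact_mod_cast hn

theorem eps_pos (h : RobustData x y B μ ε s Δ) : 0 < ε := by
  have h1 := h.one_le
  have h2 := h.card_pos
  by_contra hc
  nlinarith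

theorem delta_nonneg (h : RobustData x y B μ ε s Δ) : 0 ≤ Δ :=
  (mul_nonneg h.s_nonneg h.eps_pos.le).trans h.s_mul_le

/-- The weight missing from the good points: all of it on `B`, and `1 - w i` elsewhere. -/
noncomputable def missing (B : Finset (Fin n)) (w : Fin n → ℝ) (i : Fin n) : ℝ :=
  if i ∈ B then 1 else 1 - w i

/-- Turns a weighted sum over good points into a full clean sum minus a fractional selection, whose
weight is small enough for `tail_le`. -/
theorem sum_missing_mul (B : Finset (Fin n)) (w f : Fin n → ℝ) :
    ∑ i ∈ Bᶜ, w i * f i = ∑ i, f i - ∑ i, missing B w i * f i := by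
  rw [← Finset.sum_sub_distrib, ← Finset.sum_add_sum_compl B (fun i => f i - missing B w i * f i),
    Finset.sum_eq_zero (s := B), zero_add]
  · refine Finset.sum_congr rfl fun i hi => ?_
    rw [missing, if_neg (Finset.mem_compl.1 hi)]; ring
  · intro i hi; rw [missing, if_pos hi]; ring

theorem missing_nonneg {w : Fin n → ℝ} (hw1 : ∀ i, w i ≤ 1) (i : Fin n) :
    0 ≤ missing B w i := by
  have := hw1 i; rw [missing]; split_ifs <;> linarith

theorem missing_le_one {w : Fin n → ℝ} (hw0 : ∀ i, 0 ≤ w i) (i : Fin n) :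
    missing B w i ≤ 1 := by
  have := hw0 i; rw [missing]; split_ifs <;> linarith

theorem sum_missing_le (h : RobustData x y B μ ε s Δ) {w : Fin n → ℝ}
    (hw1 : ∀ i, w i ≤ 1) (hw : ∑ i, (1 - w i) ≤ 2 * (ε * n)) :
    ∑ i, missing B w i ≤ 3 * (ε * n) := by
  have h1 : ∀ i, missing B w i ≤ (1 - w i) + if i ∈ B then (1 : ℝ) else 0 := by
    intro i; have := hw1 i; rw [missing]; split_ifs <;> linarith
  have h2 := Finset.sum_le_sum fun i (_ : i ∈ Finset.univ) => h1 i
  rw [Finset.sum_add_distrib, Finset.sum_ite_mem, Finset.univ_inter, Finset.sum_const,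
    nsmul_eq_mul, mul_one] at h2
  linarith [h.card_le]

theorem sum_good_ge (h : RobustData x y B μ ε s Δ) {w : Fin n → ℝ}
    (hw1 : ∀ i, w i ≤ 1) (hw : ∑ i, (1 - w i) ≤ 2 * (ε * n)) :
    (n : ℝ) / 2 ≤ ∑ i ∈ Bᶜ, w i := by
  have e := sum_missing_mul B w (fun _ => 1)
  simp only [mul_one, Finset.sum_const, Finset.card_univ, Fintype.card_fin, nsmul_eq_mul] at e
  have := h.sum_missing_le hw1 hw
  nlinarith [h.eps_le, h.card_pos]

theorem sum_good_inner_sq_ge (h : RobustData x y B μ ε s Δ) {w : Fin n → ℝ}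
    (hw0 : ∀ i, 0 ≤ w i) (hw1 : ∀ i, w i ≤ 1) (hw : ∑ i, (1 - w i) ≤ 2 * (ε * n))
    {v : RVec d} (hv : ‖v‖ = 1) :
    n * (s - 4 * Δ) ≤ ∑ i ∈ Bᶜ, w i * inner ℝ v (x i - μ) ^ 2 := by
  rw [sum_missing_mul]
  have h1 := h.tail_le v hv _ (missing_nonneg (B := B) hw1) (missing_le_one hw0)
    (h.sum_missing_le hw1 hw)
  linarith [h.moment_ge v hv]

theorem sum_good_inner_sq_le (h : RobustData x y B μ ε s Δ) {w : Fin n → ℝ}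
    (hw1 : ∀ i, w i ≤ 1) {v : RVec d} (hv : ‖v‖ = 1) :
    ∑ i ∈ Bᶜ, w i * inner ℝ v (x i - μ) ^ 2 ≤ n * (s + Δ) := by
  rw [sum_missing_mul]
  have h1 : 0 ≤ ∑ i, missing B w i * inner ℝ v (x i - μ) ^ 2 :=
    Finset.sum_nonneg fun i _ => mul_nonneg (missing_nonneg hw1 i) (sq_nonneg _)
  linarith [h.moment_le v hv]

theorem sum_mul_sq_le {ι : Type*} (t : Finset ι) {u f : ι → ℝ} (hu : ∀ i, 0 ≤ u i) :
    (∑ i ∈ t, u i * f i) ^ 2 ≤ (∑ i ∈ t, u i) * ∑ i ∈ t, u i * f i ^ 2 :=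
  Finset.sum_sq_le_sum_mul_sum_of_sq_le_mul t (fun i _ => hu i)
    (fun i _ => mul_nonneg (hu i) (sq_nonneg _)) (fun i _ => le_of_eq (by ring))

/-- The full centered sum is zero, so only the missing part remains. Cauchy–Schwarz bounds its
square by the missing weight 3εn times the tail bound 3nΔ. -/
theorem sq_sum_good_inner_le (h : RobustData x y B μ ε s Δ) {w : Fin n → ℝ}
    (hw0 : ∀ i, 0 ≤ w i) (hw1 : ∀ i, w i ≤ 1) (hw : ∑ i, (1 - w i) ≤ 2 * (ε * n))
    {v : RVec d} (hv : ‖v‖ = 1) :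
    (∑ i ∈ Bᶜ, w i * inner ℝ v (x i - μ)) ^ 2 ≤ 9 * ε * n ^ 2 * Δ := by
  have h0 : ∑ i, inner ℝ v (x i - μ) = 0 := by
    rw [← inner_sum, h.centered, inner_zero_right]
  rw [sum_missing_mul, h0, zero_sub, neg_sq]
  have h1 := h.tail_le v hv _ (missing_nonneg (B := B) hw1) (missing_le_one hw0)
    (h.sum_missing_le hw1 hw)
  have h2 := sum_mul_sq_le Finset.univ (f := fun i => inner ℝ v (x i - μ))
    (missing_nonneg (B := B) hw1)
  have h3 : 0 ≤ ∑ i, missing B w i * inner ℝ v (x i - μ) ^ 2 :=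
    Finset.sum_nonneg fun i _ => mul_nonneg (missing_nonneg hw1 i) (sq_nonneg _)
  calc _ ≤ _ := h2
    _ ≤ (3 * (ε * n)) * (3 * n * Δ) := mul_le_mul (h.sum_missing_le hw1 hw) h1 h3
        (by have := h.one_le; linarith)
    _ = _ := by ring

theorem inner_sub_wmean (h : RobustData x y B μ ε s Δ) (w : Fin n → ℝ) (v : RVec d)
    {i : Fin n} (hi : i ∈ Bᶜ) :
    inner ℝ v (y i - wmean y w) = inner ℝ v (x i - μ) - inner ℝ v (wmean y w - μ) := by
  rw [← inner_sub_right, h.agree i (Finset.mem_compl.1 hi)]; congr 1; abel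

theorem sum_good_sq_eq (h : RobustData x y B μ ε s Δ) (w : Fin n → ℝ) (v : RVec d) :
    ∑ i ∈ Bᶜ, w i * inner ℝ v (y i - wmean y w) ^ 2 =
      ∑ i ∈ Bᶜ, w i * inner ℝ v (x i - μ) ^ 2 -
        2 * inner ℝ v (wmean y w - μ) * ∑ i ∈ Bᶜ, w i * inner ℝ v (x i - μ) +
        inner ℝ v (wmean y w - μ) ^ 2 * ∑ i ∈ Bᶜ, w i := by
  rw [Finset.mul_sum, Finset.mul_sum, ← Finset.sum_sub_distrib, ← Finset.sum_add_distrib]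
  refine Finset.sum_congr rfl fun i hi => ?_
  rw [h.inner_sub_wmean w v hi]; ring

/-- If the weighted second moment is nearly `s` in all directions, then the weighted mean is close
to `μ`. -/
theorem norm_wmean_sub_sq_le (h : RobustData x y B μ ε s Δ) {w : Fin n → ℝ}
    (hw0 : ∀ i, 0 ≤ w i) (hw1 : ∀ i, w i ≤ 1) (hw : ∑ i, (1 - w i) ≤ 2 * (ε * n))
    {Λ : ℝ} (hΛ : 0 ≤ Λ) (hvar : ∀ v : RVec d, ‖v‖ = 1 → wvar y w v ≤ n * (s + Λ)) :
    ‖wmean y w - μ‖ ^ 2 ≤ ε * (112 * Δ + 8 * Λ) := by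
  have hε := h.eps_pos
  have hΔ := h.delta_nonneg
  have hn := h.card_pos
  set e := wmean y w - μ with he
  set r := ‖e‖ with hr
  rcases eq_or_ne e 0 with h0 | h0
  · rw [hr, h0, norm_zero]; norm_num; positivity
  have hr0 : 0 < r := norm_pos_iff.2 h0
  -- Test in the direction of the error itself, so that its component there is its full length `r`.
  set v : RVec d := r⁻¹ • e with hvdef
  have hv : ‖v‖ = 1 := by
    rw [hvdef, norm_smul, norm_inv, Real.norm_of_nonneg hr0.le, ← hr, inv_mul_cancel₀ hr0.ne']
  have hve : inner ℝ v e = r := by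
    rw [hvdef, real_inner_smul_left, real_inner_self_eq_norm_sq, ← hr]
    field_simp
  have hG := h.sum_good_ge hw1 hw
  set WG := ∑ i ∈ Bᶜ, w i with hWG
  have hQ2 := h.sum_good_inner_sq_ge hw0 hw1 hw hv
  have hs2 := h.sq_sum_good_inner_le hw0 hw1 hw hv
  have hgood := h.sum_good_sq_eq w v
  rw [← he, hve] at hgood
  set S := ∑ i ∈ Bᶜ, w i * inner ℝ v (x i - μ) with hS
  set Q := ∑ i ∈ B, w i * inner ℝ v (y i - wmean y w) ^ 2 with hQ
  set b := ∑ i ∈ B, w i * inner ℝ v (y i - wmean y w) with hb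
  have hWpos : 0 < ∑ i, w i := by
    have : ∑ i ∈ Bᶜ, w i ≤ ∑ i, w i :=
      Finset.sum_le_sum_of_subset_of_nonneg (Finset.subset_univ _) fun i _ _ => hw0 i
    linarith
  -- The deviations from the weighted mean cancel, so a large error must be paid for by the bad
  -- points' share `b`.
  have hbal : r * WG = S + b := by
    have h1 := sum_mul_inner_sub_wmean y hWpos.ne' v
    rw [← Finset.sum_add_sum_compl B] at h1
    have h2 : ∑ i ∈ Bᶜ, w i * inner ℝ v (y i - wmean y w) = S - r * WG := by
      rw [hS, hWG, Finset.mul_sum, ← Finset.sum_sub_distrib]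
      refine Finset.sum_congr rfl fun i hi => ?_
      rw [h.inner_sub_wmean w v hi, ← he, hve]; ring
    linarith
  -- Good points already use at least n(s - 4Δ) of the allowed second moment, up to a recentring
  -- loss nΔ. The rest is all that `B` can have.
  have hQle : Q ≤ n * (Λ + 5 * Δ) := by
    have h1 := hvar v hv
    rw [wvar, ← Finset.sum_add_sum_compl B, hgood] at h1
    have h2 : 2 * r * S - r ^ 2 * WG ≤ n * Δ := by
      have h3 : r ^ 2 * (n / 2) ≤ r ^ 2 * WG := mul_le_mul_of_nonneg_left hG (sq_nonneg _)
      have h4 : 2 * r * S ≤ r ^ 2 * (n / 2) + 2 * S ^ 2 / n := by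
        have h6 : 0 ≤ (r * n - 2 * S) ^ 2 / (2 * n) := by positivity
        have h7 : (r * n - 2 * S) ^ 2 / (2 * n) = r ^ 2 * (n / 2) - 2 * r * S + 2 * S ^ 2 / n := by
          field_simp; ring
        linarith
      have h5 : 2 * S ^ 2 / n ≤ n * Δ := by
        rw [div_le_iff₀ hn]
        have h8 : 18 * ε * (n ^ 2 * Δ) ≤ 1 * (n ^ 2 * Δ) :=
          mul_le_mul_of_nonneg_right (by linarith [h.eps_le]) (by positivity)
        nlinarith
      linarith
    nlinarith
  have hb2 : b ^ 2 ≤ ε * n ^ 2 * (Λ + 5 * Δ) := by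
    have h1 := sum_mul_sq_le B (f := fun i => inner ℝ v (y i - wmean y w)) hw0
    have h2 : ∑ i ∈ B, w i ≤ ε * n := by
      refine le_trans (Finset.sum_le_sum fun i _ => hw1 i) ?_
      simpa using h.card_le
    have h3 : 0 ≤ Q := Finset.sum_nonneg fun i _ => mul_nonneg (hw0 i) (sq_nonneg _)
    calc b ^ 2 ≤ _ := h1
      _ ≤ (ε * n) * (n * (Λ + 5 * Δ)) := mul_le_mul h2 hQle h3 (by positivity)
      _ = _ := by ring
  -- With S² ≤ 9εn²Δ and b² ≤ εn²(Λ + 5Δ), multiplying by 4 gives the constants 112 = 4(18 + 10) and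
  -- 8 = 4 · 2.
  have hfin : (r * (n / 2)) ^ 2 ≤ 2 * S ^ 2 + 2 * b ^ 2 := by
    have h1 : r * (n / 2) ≤ S + b := hbal ▸ mul_le_mul_of_nonneg_left hG hr0.le
    have h2 : (r * (n / 2)) ^ 2 ≤ (S + b) ^ 2 := pow_le_pow_left₀ (by positivity) h1 2
    nlinarith [sq_nonneg (S - b)]
  have hn2 : (0 : ℝ) < n ^ 2 := by positivity
  have : n ^ 2 * r ^ 2 ≤ n ^ 2 * (ε * (112 * Δ + 8 * Λ)) := by nlinarith
  exact le_of_mul_le_mul_left this hn2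

end RobustData

/-! ### Powers of the scatter matrix -/

open Matrix in
/-- The unnormalised weighted covariance matrix. -/
noncomputable def scatter {n d : ℕ} (y : Points n d) (w : Fin n → ℝ) : Matrix (Fin d) (Fin d) ℝ :=
  ∑ i, w i • vecMulVec (y i - wmean y w).ofLp (y i - wmean y w).ofLp

open Matrix in
/-- The quadratic form of the power of the scatter matrix that is used to detect outliers. -/
noncomputable def outlierScore {n d : ℕ} (y : Points n d) (w : Fin n → ℝ) (i : Fin n) : ℝ :=
  (y i - wmean y w).ofLp ⬝ᵥ (scatter y w ^ 2 ^ (n + d) *ᵥ (y i - wmean y w).ofLp)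

/-- In the factorisation of b^(m+1) - a^(m+1) by b - a, each of the m + 1 terms of the cofactor is
at least a^m. -/
theorem pow_mul_sub_le {a b : ℝ} (ha : 0 ≤ a) (hab : a ≤ b) (m : ℕ) :
    (m + 1) * (a ^ m * (b - a)) ≤ b ^ (m + 1) - a ^ (m + 1) := by
  induction m with
  | zero => simp
  | succ m ih =>
    have h1 : a ^ (m + 1) ≤ b ^ (m + 1) := pow_le_pow_left₀ ha hab _
    have h2 : a * ((m + 1) * (a ^ m * (b - a))) ≤ a * (b ^ (m + 1) - a ^ (m + 1)) :=
      mul_le_mul_of_nonneg_left ih ha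
    have h3 : 0 ≤ (b - a) * (b ^ (m + 1) - a ^ (m + 1)) :=
      mul_nonneg (sub_nonneg.2 hab) (sub_nonneg.2 h1)
    push_cast
    have e1 : b ^ (m + 1 + 1) = b * b ^ (m + 1) := by ring
    have e2 : a ^ (m + 1 + 1) = a * a ^ (m + 1) := by ring
    have e3 : a * ((m + 1) * (a ^ m * (b - a))) = (m + 1) * (a ^ (m + 1) * (b - a)) := by ring
    rw [e3] at h2
    rw [e1, e2]
    linarith

/-- The ratio of consecutive high power sums approximates the maximum. -/
theorem max_mul_sum_pow_le {d n m : ℕ} (hm : n * d ≤ m) {lam : Fin d → ℝ}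
    (h0 : ∀ l, 0 ≤ lam l) (l₀ : Fin d) (hmax : ∀ l, lam l ≤ lam l₀) :
    n * (lam l₀ * ∑ l, lam l ^ m) ≤ (n + 1) * ∑ l, lam l ^ (m + 1) := by
  set b := lam l₀
  have hd : (0 : ℝ) < d := by exact_mod_cast l₀.pos
  have hb : b ^ (m + 1) ≤ ∑ l, lam l ^ (m + 1) :=
    Finset.single_le_sum (f := fun l => lam l ^ (m + 1))
      (fun l _ => pow_nonneg (h0 l) _) (Finset.mem_univ l₀)
  -- An eigenvalue well below `b` is suppressed by the power. Each of the `d` deficits is at most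
  -- b^(m+1)/(nd), and b^(m+1) is itself a term of the larger power sum.
  have h1 : ∀ l, (n * d : ℝ) * (lam l ^ m * (b - lam l)) ≤ b ^ (m + 1) := by
    intro l
    have h2 := pow_mul_sub_le (h0 l) (hmax l) m
    have h3 : 0 ≤ lam l ^ m * (b - lam l) :=
      mul_nonneg (pow_nonneg (h0 l) _) (sub_nonneg.2 (hmax l))
    have h4 : (n * d : ℝ) ≤ m + 1 := by
      have : (n * d : ℝ) ≤ m := by exact_mod_cast hm
      linarith
    have h5 := mul_le_mul_of_nonneg_right h4 h3
    have h6 := pow_nonneg (h0 l) (m + 1)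
    linarith
  have h2 := Finset.sum_le_sum fun l (_ : l ∈ Finset.univ) => h1 l
  rw [← Finset.mul_sum, Finset.sum_const, Finset.card_univ, Fintype.card_fin, nsmul_eq_mul] at h2
  have h3 : ∑ l, lam l ^ m * (b - lam l) = b * ∑ l, lam l ^ m - ∑ l, lam l ^ (m + 1) := by
    rw [Finset.mul_sum, ← Finset.sum_sub_distrib]
    exact Finset.sum_congr rfl fun l _ => by ring
  rw [h3] at h2
  have h4 : (d : ℝ) * (n * (b * ∑ l, lam l ^ m - ∑ l, lam l ^ (m + 1))) ≤ d * b ^ (m + 1) := by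
    linarith
  have h5 := le_of_mul_le_mul_left h4 hd
  linarith

/-- So n + d squarings reach the exponent required by `max_mul_sum_pow_le`. -/
theorem mul_le_two_pow_add (n d : ℕ) : n * d ≤ 2 ^ (n + d) := by
  rw [pow_add]
  exact Nat.mul_le_mul Nat.lt_two_pow_self.le Nat.lt_two_pow_self.le

open Matrix in
theorem dotProduct_scatter_mulVec {n d : ℕ} (y : Points n d) (w : Fin n → ℝ) (v : RVec d) :
    v.ofLp ⬝ᵥ (scatter y w *ᵥ v.ofLp) = wvar y w v := by
  rw [scatter, sum_mulVec, dotProduct_sum, wvar]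
  refine Finset.sum_congr rfl fun i _ => ?_
  rw [smul_mulVec, dotProduct_smul, vecMulVec_mulVec, smul_eq_mul]
  simp only [EuclideanSpace.inner_eq_star_dotProduct, star_trivial, op_smul_eq_smul,
    dotProduct_smul, smul_eq_mul]
  rw [dotProduct_comm v.ofLp, sq]

open Matrix in
theorem isHermitian_scatter {n d : ℕ} (y : Points n d) (w : Fin n → ℝ) :
    (scatter y w).IsHermitian := by
  ext j l
  simp only [scatter, conjTranspose_apply, star_trivial, Matrix.sum_apply, Matrix.smul_apply,
    vecMulVec_apply]
  exact Finset.sum_congr rfl fun i _ => by rw [mul_comm ((y i - wmean y w).ofLp l)]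

open Matrix in
/-- Diagonalisation of the scatter matrix. -/
theorem exists_scatter_diagonalization {n d : ℕ} (y : Points n d) {w : Fin n → ℝ}
    (hw : ∀ i, 0 ≤ w i) : ∃ (v : OrthonormalBasis (Fin d) ℝ (RVec d)) (lam : Fin d → ℝ),
      (∀ l, 0 ≤ lam l) ∧ (∀ l, wvar y w (v l) = lam l) ∧
      ∀ (m : ℕ) (z : RVec d),
        z.ofLp ⬝ᵥ (scatter y w ^ m *ᵥ z.ofLp) = ∑ l, lam l ^ m * inner ℝ (v l) z ^ 2 := by
  set hA := isHermitian_scatter y w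
  have hpow : ∀ (m : ℕ) (l : Fin d), scatter y w ^ m *ᵥ (hA.eigenvectorBasis l).ofLp =
      hA.eigenvalues l ^ m • (hA.eigenvectorBasis l).ofLp := by
    intro m l
    induction m with
    | zero => simp
    | succ m ih =>
      rw [pow_succ, ← mulVec_mulVec, hA.mulVec_eigenvectorBasis, mulVec_smul, ih, smul_smul,
        pow_succ, mul_comm]
  have hquad : ∀ (m : ℕ) (z : RVec d), z.ofLp ⬝ᵥ (scatter y w ^ m *ᵥ z.ofLp) =
      ∑ l, hA.eigenvalues l ^ m * inner ℝ (hA.eigenvectorBasis l) z ^ 2 := by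
    intro m z
    have hz : z.ofLp = ∑ l, inner ℝ (hA.eigenvectorBasis l) z •
        (hA.eigenvectorBasis l).ofLp := by
      conv_lhs => rw [← hA.eigenvectorBasis.sum_repr' z]
      simp
    conv_lhs => rw [hz, mulVec_sum, ← hz, dotProduct_sum]
    refine Finset.sum_congr rfl fun l _ => ?_
    rw [mulVec_smul, hpow, dotProduct_smul, dotProduct_smul]
    have : inner ℝ (hA.eigenvectorBasis l) z = z.ofLp ⬝ᵥ (hA.eigenvectorBasis l).ofLp := by
      simp [EuclideanSpace.inner_eq_star_dotProduct]
    rw [this]; simp only [smul_eq_mul]; ring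
  have hvar : ∀ l, wvar y w (hA.eigenvectorBasis l) = hA.eigenvalues l := by
    intro l
    have := hquad 1 (hA.eigenvectorBasis l)
    rw [pow_one, dotProduct_scatter_mulVec] at this
    rw [this]
    simp [OrthonormalBasis.inner_eq_ite]
  refine ⟨hA.eigenvectorBasis, hA.eigenvalues, fun l => ?_, hvar, hquad⟩
  rw [← hvar]
  exact Finset.sum_nonneg fun i _ => mul_nonneg (hw i) (sq_nonneg _)

/-! ### Outlier scores of good and bad points -/

namespace RobustData

variable {n d : ℕ} {x y : Points n d} {B : Finset (Fin n)} {μ : RVec d} {ε s Δ : ℝ}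

theorem inner_sq_le_norm_sq {v z : RVec d} (hv : ‖v‖ = 1) : inner ℝ v z ^ 2 ≤ ‖z‖ ^ 2 := by
  have h := abs_real_inner_le_norm v z
  rw [hv, one_mul] at h
  exact sq_le_sq' (neg_le_of_abs_le h) (le_of_abs_le h)

/-- Recentring from `μ` to the weighted mean costs the squared shift once directly and once through
the cross term, whose other half S²/n is at most nΔ. -/
theorem sum_good_sq_le (h : RobustData x y B μ ε s Δ) {w : Fin n → ℝ}
    (hw0 : ∀ i, 0 ≤ w i) (hw1 : ∀ i, w i ≤ 1) (hw : ∑ i, (1 - w i) ≤ 2 * (ε * n))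
    {v : RVec d} (hv : ‖v‖ = 1) :
    ∑ i ∈ Bᶜ, w i * inner ℝ v (y i - wmean y w) ^ 2 ≤
      n * (s + 2 * Δ + 2 * ‖wmean y w - μ‖ ^ 2) := by
  rw [h.sum_good_sq_eq w v]
  have h1 := h.sum_good_inner_sq_le hw1 hv
  have h2 := h.sq_sum_good_inner_le hw0 hw1 hw hv
  have h3 := inner_sq_le_norm_sq (z := wmean y w - μ) hv
  set c := inner ℝ v (wmean y w - μ)
  set S := ∑ i ∈ Bᶜ, w i * inner ℝ v (x i - μ)
  have hn := h.card_pos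
  have hΔ := h.delta_nonneg
  have h4 : ∑ i ∈ Bᶜ, w i ≤ n := by
    refine (Finset.sum_le_sum fun i _ => hw1 i).trans ?_
    simp only [Finset.sum_const, nsmul_eq_mul, mul_one]
    exact_mod_cast (Finset.card_le_univ _).trans_eq (Fintype.card_fin n)
  have h5 : c ^ 2 * ∑ i ∈ Bᶜ, w i ≤ c ^ 2 * n := mul_le_mul_of_nonneg_left h4 (sq_nonneg _)
  have h6 : -(2 * c * S) ≤ c ^ 2 * n + S ^ 2 / n := by
    have h7 : 0 ≤ (c * n + S) ^ 2 / n := by positivity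
    have h8 : (c * n + S) ^ 2 / n = c ^ 2 * n + 2 * c * S + S ^ 2 / n := by field_simp; ring
    linarith
  have h7 : S ^ 2 / n ≤ n * Δ := by
    rw [div_le_iff₀ hn]
    have h8 : 9 * ε * (n ^ 2 * Δ) ≤ 1 * (n ^ 2 * Δ) :=
      mul_le_mul_of_nonneg_right (by linarith [h.eps_le]) (by positivity)
    nlinarith
  have h8 := mul_le_mul_of_nonneg_left h3 hn.le
  nlinarith

/-- At most εn good points are involved, so the tail bound applies; the factor 2 is from (a - b)² ≤
2a² + 2b². -/
theorem sum_top_good_sq_le (h : RobustData x y B μ ε s Δ) {w : Fin n → ℝ}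
    (hw1 : ∀ i, w i ≤ 1) {L : Finset (Fin n)} (hL : (L.card : ℝ) ≤ ε * n)
    {v : RVec d} (hv : ‖v‖ = 1) :
    ∑ i ∈ L \ B, w i * inner ℝ v (y i - wmean y w) ^ 2 ≤
      n * (6 * Δ + 2 * ε * ‖wmean y w - μ‖ ^ 2) := by
  have h3 := inner_sq_le_norm_sq (z := wmean y w - μ) hv
  have hcard : ((L \ B).card : ℝ) ≤ ε * n :=
    le_trans (by exact_mod_cast Finset.card_le_card Finset.sdiff_subset) hL
  have hpos := h.one_le
  have htail := h.tail_le v hv (fun i => if i ∈ L \ B then 1 else 0)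
    (fun i => by split_ifs <;> norm_num) (fun i => by split_ifs <;> norm_num)
    (by rw [Finset.sum_ite_mem, Finset.univ_inter, Finset.sum_const, nsmul_eq_mul, mul_one]
        linarith)
  simp only [ite_mul, one_mul, zero_mul, Finset.sum_ite_mem, Finset.univ_inter] at htail
  have h1 : ∀ i ∈ L \ B, w i * inner ℝ v (y i - wmean y w) ^ 2 ≤
      2 * inner ℝ v (x i - μ) ^ 2 + 2 * ‖wmean y w - μ‖ ^ 2 := by
    intro i hi
    have hi' : i ∈ Bᶜ := Finset.mem_compl.2 (Finset.mem_sdiff.1 hi).2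
    refine (mul_le_of_le_one_left (sq_nonneg _) (hw1 i)).trans ?_
    rw [h.inner_sub_wmean w v hi']
    nlinarith [sq_nonneg (inner ℝ v (x i - μ) + inner ℝ v (wmean y w - μ))]
  refine (Finset.sum_le_sum h1).trans ?_
  rw [Finset.sum_add_distrib, ← Finset.mul_sum, Finset.sum_const, nsmul_eq_mul]
  have h2 := mul_le_mul_of_nonneg_right hcard (sq_nonneg ‖wmean y w - μ‖)
  linarith

/-- If at least half of the total score of the most suspicious points comes from good points, then
the weighted second moment is nearly `s` in all directions. -/
theorem wvar_le_of_top_good (h : RobustData x y B μ ε s Δ) {w : Fin n → ℝ}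
    (hw0 : ∀ i, 0 ≤ w i) (hw1 : ∀ i, w i ≤ 1) (hw : ∑ i, (1 - w i) ≤ 2 * (ε * n))
    {L : Finset (Fin n)} (hL : (L.card : ℝ) ≤ ε * n) (hL' : ε * n < L.card + 1)
    (htop : ∀ i ∈ L, ∀ j ∉ L, w j * outlierScore y w j ≤ w i * outlierScore y w i)
    (hgood : ∑ i ∈ L ∩ B, w i * outlierScore y w i ≤ ∑ i ∈ L \ B, w i * outlierScore y w i)
    {v : RVec d} (hv : ‖v‖ = 1) : wvar y w v ≤ n * (s + 42 * Δ) := by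
  have hε := h.eps_pos
  have hε' := h.eps_le
  have hΔ := h.delta_nonneg
  have hn := h.card_pos
  have hs := h.s_nonneg
  obtain ⟨b, lam, hlam, hblam, hquad⟩ := exists_scatter_diagonalization y hw0
  set m := 2 ^ (n + d) with hm
  have hvarsum : ∀ z : RVec d, wvar y w z = ∑ l, lam l * inner ℝ (b l) z ^ 2 := by
    intro z
    rw [← dotProduct_scatter_mulVec, ← pow_one (scatter y w), hquad]
    simp only [pow_one]
  have hscore : ∀ i, outlierScore y w i =
      ∑ l, lam l ^ m * inner ℝ (b l) (y i - wmean y w) ^ 2 := fun i => hquad m _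
  have hscore0 : ∀ i, 0 ≤ w i * outlierScore y w i := fun i => by
    rw [hscore]
    exact mul_nonneg (hw0 i) (Finset.sum_nonneg fun l _ =>
      mul_nonneg (pow_nonneg (hlam l) _) (sq_nonneg _))
  have hswap : ∀ t : Finset (Fin n), ∑ i ∈ t, w i * outlierScore y w i =
      ∑ l, lam l ^ m * ∑ i ∈ t, w i * inner ℝ (b l) (y i - wmean y w) ^ 2 := by
    intro t
    simp only [hscore, Finset.mul_sum]
    rw [Finset.sum_comm]
    exact Finset.sum_congr rfl fun l _ => Finset.sum_congr rfl fun i _ => by ring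
  have hbound : ∀ (t : Finset (Fin n)) (c : ℝ),
      (∀ u : RVec d, ‖u‖ = 1 → ∑ i ∈ t, w i * inner ℝ u (y i - wmean y w) ^ 2 ≤ c) →
      ∑ i ∈ t, w i * outlierScore y w i ≤ (∑ l, lam l ^ m) * c := by
    intro t c hc
    rw [hswap, Finset.sum_mul]
    exact Finset.sum_le_sum fun l _ => mul_le_mul_of_nonneg_left
      (hc _ (b.orthonormal.1 l)) (pow_nonneg (hlam l) _)
  set E := ‖wmean y w - μ‖ ^ 2 with hE
  set P := ∑ l, lam l ^ m with hP
  have hP0 : 0 ≤ P := Finset.sum_nonneg fun l _ => pow_nonneg (hlam l) _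
  have h1 := hbound Bᶜ _ fun u hu => h.sum_good_sq_le hw0 hw1 hw hu
  have h2 := hbound (L \ B) _ fun u hu => h.sum_top_good_sq_le hw1 hL hu
  -- Since |B| ≤ εn < |L| + 1, the set `L` is at least as large as `B` and, having the top scores,
  -- outweighs it. By `hgood`, the score of `B` is then at most twice that of the good points in
  -- `L`.
  have h3 : ∑ i ∈ B, w i * outlierScore y w i ≤ ∑ i ∈ L, w i * outlierScore y w i := by
    have hc : B.card ≤ L.card := by
      have : (B.card : ℝ) < L.card + 1 := h.card_le.trans_lt hL'
      exact Nat.lt_succ_iff.1 (by exact_mod_cast this)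
    have := sum_mul_le_sum_top (u := fun i => if i ∈ B then 1 else 0) hscore0
      (fun i => by split_ifs <;> norm_num) (fun i => by split_ifs <;> norm_num) htop
      (by rw [Finset.sum_ite_mem, Finset.univ_inter, Finset.sum_const, nsmul_eq_mul, mul_one]
          exact_mod_cast hc)
    simpa only [ite_mul, one_mul, zero_mul, Finset.sum_ite_mem, Finset.univ_inter] using this
  have h4 := Finset.sum_inter_add_sum_sdiff L B (fun i => w i * outlierScore y w i)
  -- The total weighted score is the trace of the next power of the scatter matrix.
  have h5 : ∑ i, w i * outlierScore y w i = ∑ l, lam l ^ (m + 1) := by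
    rw [hswap]
    refine Finset.sum_congr rfl fun l _ => ?_
    rw [pow_succ, ← hblam l, wvar]
  have h6 := Finset.sum_add_sum_compl B (fun i => w i * outlierScore y w i)
  have hne : Nonempty (Fin d) := by
    by_contra hc
    rw [not_nonempty_iff] at hc
    have : v = 0 := Subsingleton.elim _ _
    rw [this, norm_zero] at hv
    exact zero_ne_one hv
  obtain ⟨l₀, hmax⟩ := Finite.exists_max lam
  have hvar : ∀ u : RVec d, ‖u‖ = 1 → wvar y w u ≤ lam l₀ := by
    intro u hu
    rw [hvarsum]
    calc ∑ l, lam l * inner ℝ (b l) u ^ 2 ≤ ∑ l, lam l₀ * inner ℝ (b l) u ^ 2 :=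
          Finset.sum_le_sum fun l _ => mul_le_mul_of_nonneg_right (hmax l) (sq_nonneg _)
      _ = lam l₀ := by
        rw [← Finset.mul_sum]
        have := b.sum_sq_norm_inner_right u
        simp only [Real.norm_eq_abs, sq_abs] at this
        rw [this, hu]; ring
  refine (hvar v hv).trans ?_
  by_contra! hcon
  -- `Λ` is the excess of the top eigenvalue. The error `E` is at most ε(112Δ + 8Λ), and ε ≤ 1/2000
  -- makes its `Λ` part small enough for the bound on the eigenvalue to close on itself.
  set Λ := lam l₀ / n - s with hΛdef
  have hlΛ : lam l₀ = n * (s + Λ) := by rw [hΛdef]; field_simp; ring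
  have hΛ : 42 * Δ < Λ := by
    rw [hlΛ] at hcon
    have := lt_of_mul_lt_mul_left hcon hn.le
    linarith
  have herr := h.norm_wmean_sub_sq_le hw0 hw1 hw (by linarith : (0 : ℝ) ≤ Λ)
    (fun u hu => hlΛ ▸ hvar u hu)
  rw [← hE] at herr
  have hlpos : 0 < lam l₀ := lt_of_le_of_lt (by positivity) hcon
  have hPpos : 0 < P := lt_of_lt_of_le (pow_pos hlpos m)
    (Finset.single_le_sum (f := fun l => lam l ^ m) (fun l _ => pow_nonneg (hlam l) _)
      (Finset.mem_univ l₀))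
  have hpow := max_mul_sum_pow_le (mul_le_two_pow_add n d) hlam l₀ hmax
  rw [← hm, ← hP, ← h5] at hpow
  have htot : ∑ i, w i * outlierScore y w i ≤ P * (n * (s + 14 * Δ + 3 * E)) := by
    have : ∑ i, w i * outlierScore y w i ≤
        P * (n * (s + 14 * Δ + 2 * E + 4 * ε * E)) := by linarith
    refine this.trans (mul_le_mul_of_nonneg_left (mul_le_mul_of_nonneg_left ?_ hn.le) hP0)
    have : 0 ≤ E := sq_nonneg _
    nlinarith
  have h7 : P * (n * lam l₀) ≤ P * (n * ((n + 1) * (s + 14 * Δ + 3 * E))) := by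
    have h8 := mul_le_mul_of_nonneg_left htot (by positivity : (0 : ℝ) ≤ n + 1)
    linarith
  have h8 := le_of_mul_le_mul_left (le_of_mul_le_mul_left h7 hPpos) hn
  have hΛ0 : 0 < Λ := lt_of_le_of_lt (by positivity) hΛ
  have h9 : 3 * E ≤ Δ + Λ / 8 := by
    have : ε * (112 * Δ + 8 * Λ) ≤ 1 / 2000 * (112 * Δ + 8 * Λ) :=
      mul_le_mul_of_nonneg_right hε' (by positivity)
    linarith
  have hn1 : (1 : ℝ) ≤ n := by
    have := h.one_le
    nlinarith
  -- Absorbs the factor (n+1)/n lost in the power method: the extra `s` is affordable because sε ≤ Δ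
  -- and 1 ≤ εn.
  have h10 : s ≤ n * Δ := by
    have h11 : s * 1 ≤ s * (ε * n) := mul_le_mul_of_nonneg_left h.one_le hs
    have h12 := mul_le_mul_of_nonneg_right h.s_mul_le hn.le
    linarith
  have h11 : lam l₀ ≤ (n + 1) * (s + 15 * Δ + Λ / 8) :=
    h8.trans (mul_le_mul_of_nonneg_left (by linarith) (by positivity))
  rw [hlΛ] at h11
  have h12 : 0 ≤ (n - 1) * (15 * Δ + Λ / 8) := mul_nonneg (by linarith) (by positivity)
  have h13 : n * Λ ≤ n * (31 * Δ + Λ / 4) := by nlinarith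
  have h14 := le_of_mul_le_mul_left h13 hn
  linarith

end RobustData

/-! ### The filter -/

section Filter

variable {n d : ℕ}

/-- Lower the weights on `L` in proportion to the scores. -/
noncomputable def downweight (w g : Fin n → ℝ) (L : Finset (Fin n)) (c : ℝ) (i : Fin n) : ℝ :=
  if i ∈ L then w i - w i * g i / c else w i

open Classical in
/-- One step of the filter: the weights of the `⌊τ⌋` points with the largest weighted scores are
lowered in proportion to the scores, so that one of them vanishes; the step is undone if the total
weight removed so far exceeds `2 τ`. -/
def IsFilterStep (y : Points n d) (τ : ℝ) (w w' : Fin n → ℝ) : Prop :=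
  ∃ (L : Finset (Fin n)) (c : ℝ),
    (∀ i ∈ L, ∀ j ∉ L, w j * outlierScore y w j ≤ w i * outlierScore y w i) ∧
    (0 ≤ τ → τ ≤ n → (L.card : ℝ) ≤ τ ∧ τ < L.card + 1) ∧
    (∀ i ∈ L, 0 < w i → outlierScore y w i ≤ c) ∧
    (c = 0 ∨ ∃ i ∈ L, 0 < w i ∧ outlierScore y w i = c) ∧
    w' = if ∑ i, (1 - downweight w (outlierScore y w) L c i) ≤ 2 * τ
      then downweight w (outlierScore y w) L c else w

theorem outlierScore_nonneg (y : Points n d) {w : Fin n → ℝ} (hw : ∀ i, 0 ≤ w i) (i : Fin n) :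
    0 ≤ outlierScore y w i := by
  obtain ⟨b, lam, hlam, -, hquad⟩ := exists_scatter_diagonalization y hw
  rw [outlierScore, hquad]
  exact Finset.sum_nonneg fun l _ => mul_nonneg (pow_nonneg (hlam l) _) (sq_nonneg _)

theorem downweight_le {w g : Fin n → ℝ} {L : Finset (Fin n)} {c : ℝ} (hw : ∀ i, 0 ≤ w i)
    (hg : ∀ i, 0 ≤ g i) (hc : 0 ≤ c) (i : Fin n) : downweight w g L c i ≤ w i := by
  rw [downweight]
  split_ifs
  · have := div_nonneg (mul_nonneg (hw i) (hg i)) hc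
    linarith
  · exact le_rfl

theorem downweight_nonneg {w g : Fin n → ℝ} {L : Finset (Fin n)} {c : ℝ} (hw : ∀ i, 0 ≤ w i)
    (hc : 0 ≤ c) (hgc : ∀ i ∈ L, 0 < w i → g i ≤ c) (i : Fin n) :
    0 ≤ downweight w g L c i := by
  rw [downweight]
  split_ifs with hi
  · rcases (hw i).eq_or_lt with h0 | h0
    · simp [← h0]
    · rw [mul_div_assoc]
      have : g i / c ≤ 1 := div_le_one_of_le₀ (hgc i hi h0) hc
      nlinarith
  · exact hw i

theorem IsFilterStep.mem_Icc {y : Points n d} {τ : ℝ} {w w' : Fin n → ℝ}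
    (h : IsFilterStep y τ w w') (hw : ∀ i, 0 ≤ w i) : ∀ i, 0 ≤ w' i ∧ w' i ≤ w i := by
  obtain ⟨L, c, -, -, hgc, hc, rfl⟩ := h
  have hg := outlierScore_nonneg y hw
  have hc0 : 0 ≤ c := by
    rcases hc with rfl | ⟨i, -, -, rfl⟩
    · exact le_rfl
    · exact hg i
  intro i
  split_ifs
  · exact ⟨downweight_nonneg hw hc0 hgc i, downweight_le hw hg hc0 i⟩
  · exact ⟨hw i, le_rfl⟩

theorem IsFilterStep.sum_removed_le {y : Points n d} {τ : ℝ} {w w' : Fin n → ℝ}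
    (h : IsFilterStep y τ w w') (hw : ∑ i, (1 - w i) ≤ 2 * τ) : ∑ i, (1 - w' i) ≤ 2 * τ := by
  obtain ⟨L, c, -, -, -, -, rfl⟩ := h
  split_ifs with h1
  · exact h1
  · exact hw

/-- Nothing is removed if fewer than one point may be corrupted. -/
theorem IsFilterStep.eq_of_lt_one {y : Points n d} {τ : ℝ} {w w' : Fin n → ℝ}
    (h : IsFilterStep y τ w w') (h0 : 0 ≤ τ) (h1 : τ < 1) (hn : τ ≤ n) : w' = w := by
  obtain ⟨L, c, -, hcard, -, -, rfl⟩ := h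
  have hL : L = ∅ := by
    have : (L.card : ℝ) < 1 := (hcard h0 hn).1.trans_lt h1
    rw [← Finset.card_eq_zero]
    exact Nat.lt_one_iff.1 (by exact_mod_cast this)
  have : downweight w (outlierScore y w) L c = w := by
    funext i; simp [downweight, hL]
  rw [this, ite_self]

variable {x y : Points n d} {B : Finset (Fin n)} {μ : RVec d} {ε s Δ : ℝ}

/-- The weight removed from the good points does not exceed that removed from the bad points. -/
def RemovesMoreBad (B : Finset (Fin n)) (w : Fin n → ℝ) : Prop :=
  ∑ i ∈ Bᶜ, (1 - w i) ≤ ∑ i ∈ B, (1 - w i)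

/-- The bad points can lose at most |B| ≤ εn, hence so can the good ones. A step preserving the
invariant is thus never undone. -/
theorem RobustData.sum_removed_le (h : RobustData x y B μ ε s Δ) {w : Fin n → ℝ}
    (hw : ∀ i, 0 ≤ w i) (hB : RemovesMoreBad B w) : ∑ i, (1 - w i) ≤ 2 * (ε * n) := by
  have h1 : ∑ i ∈ B, (1 - w i) ≤ B.card := by
    calc ∑ i ∈ B, (1 - w i) ≤ ∑ i ∈ B, (1 : ℝ) :=
          Finset.sum_le_sum fun i _ => by linarith [hw i]
      _ = B.card := by simp
  rw [← Finset.sum_add_sum_compl B]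
  have := h.card_le
  rw [RemovesMoreBad] at hB
  linarith

/-- Either the second moment is under control, or the next step removes more weight from the bad
points than from the good ones and kills a further point. -/
theorem RobustData.wvar_le_or_filterStep (h : RobustData x y B μ ε s Δ) {w w' : Fin n → ℝ}
    (hstep : IsFilterStep y (ε * n) w w') (hw0 : ∀ i, 0 ≤ w i) (hw1 : ∀ i, w i ≤ 1)
    (hB : RemovesMoreBad B w) :
    (∀ v : RVec d, ‖v‖ = 1 → wvar y w v ≤ n * (s + 42 * Δ)) ∨
      (RemovesMoreBad B w' ∧ ∃ i, 0 < w i ∧ w' i = 0) := by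
  have hw := h.sum_removed_le hw0 hB
  obtain ⟨L, c, htop, hcard, hgc, hc, rfl⟩ := hstep
  have hτ : ε * n ≤ n := by nlinarith [h.eps_le, h.card_pos]
  obtain ⟨hL, hL'⟩ := hcard (by linarith [h.one_le]) hτ
  set g := outlierScore y w with hgdef
  have hg := outlierScore_nonneg y hw0
  rcases le_or_gt (∑ i ∈ L ∩ B, w i * g i) (∑ i ∈ L \ B, w i * g i) with hle | hlt
  · exact Or.inl fun v hv => h.wvar_le_of_top_good hw0 hw1 hw hL hL' htop hle hv
  right
  -- The strict inequality `hlt` forces a positive weighted score on `L ∩ B`, which c ≤ 0 would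
  -- exclude.
  have hcpos : 0 < c := by
    by_contra! hc0
    have h1 : ∑ i ∈ L ∩ B, w i * g i ≤ 0 := by
      refine Finset.sum_nonpos fun i hi => ?_
      rcases (hw0 i).eq_or_lt with h0 | h0
      · simp [← h0]
      · exact mul_nonpos_of_nonneg_of_nonpos (hw0 i)
          ((hgc i (Finset.mem_inter.1 hi).1 h0).trans hc0)
    have h2 : 0 ≤ ∑ i ∈ L \ B, w i * g i :=
      Finset.sum_nonneg fun i _ => mul_nonneg (hw0 i) (hg i)
    linarith
  have hsum : ∀ t : Finset (Fin n), ∑ i ∈ t, (1 - downweight w g L c i) =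
      ∑ i ∈ t, (1 - w i) + (∑ i ∈ t ∩ L, w i * g i) / c := by
    intro t
    rw [Finset.sum_div, ← Finset.sum_ite_mem, ← Finset.sum_add_distrib]
    refine Finset.sum_congr rfl fun i _ => ?_
    rw [downweight]
    split_ifs <;> ring
  have hB' : RemovesMoreBad B (downweight w g L c) := by
    rw [RemovesMoreBad, hsum, hsum, Finset.inter_comm B, Finset.inter_comm Bᶜ,
      ← Finset.sdiff_eq_inter_compl]
    have := div_le_div_of_nonneg_right hlt.le hcpos.le
    rw [RemovesMoreBad] at hB
    linarith
  have hacc : ∑ i, (1 - downweight w g L c i) ≤ 2 * (ε * n) :=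
    h.sum_removed_le (downweight_nonneg hw0 hcpos.le hgc) hB'
  rw [if_pos hacc]
  refine ⟨hB', ?_⟩
  obtain ⟨i, hi, hwi, hgi⟩ := hc.resolve_left hcpos.ne'
  refine ⟨i, hwi, ?_⟩
  rw [downweight, if_pos hi, hgi, mul_div_cancel_right₀ _ hcpos.ne', sub_self]

/-- If the second moment were too large before each of the `n` steps, every weight would vanish,
contradicting the cap 2εn < n on the removed weight. Once it is under control it stays so, and 448 =
112 + 8 · 42. -/
theorem RobustData.norm_wmean_sub_sq_le_of_filter (h : RobustData x y B μ ε s Δ)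
    {W : ℕ → Fin n → ℝ} (h0 : W 0 = fun _ => 1)
    (hstep : ∀ k, IsFilterStep y (ε * n) (W k) (W (k + 1))) :
    ‖wmean y (W n) - μ‖ ^ 2 ≤ ε * (448 * Δ) := by
  have hΔ := h.delta_nonneg
  have hn := h.card_pos
  have hε := h.eps_pos
  have hnonneg : ∀ k i, 0 ≤ W k i := by
    intro k
    induction k with
    | zero => intro i; rw [h0]; exact zero_le_one
    | succ k ih => exact fun i => ((hstep k).mem_Icc ih i).1
  have hanti : Antitone W := antitone_nat_of_succ_le fun k i =>
    ((hstep k).mem_Icc (hnonneg k) i).2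
  have hle1 : ∀ k i, W k i ≤ 1 := fun k i => by
    have := hanti (Nat.zero_le k) i
    rwa [h0] at this
  have hrem : ∀ k, ∑ i, (1 - W k i) ≤ 2 * (ε * n) := by
    intro k
    induction k with
    | zero => rw [h0]; simp; positivity
    | succ k ih => exact (hstep k).sum_removed_le ih
  obtain ⟨k, hk, hvar⟩ : ∃ k < n, ∀ v : RVec d, ‖v‖ = 1 → wvar y (W k) v ≤ n * (s + 42 * Δ) := by
    by_contra! hcon
    have hind : ∀ k ≤ n, RemovesMoreBad B (W k) ∧
        k ≤ (Finset.univ.filter fun i => W k i = 0).card := by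
      intro k
      induction k with
      | zero => intro _; simp [RemovesMoreBad, h0]
      | succ k ih =>
        intro hk
        obtain ⟨hB, hz⟩ := ih (by omega)
        rcases h.wvar_le_or_filterStep (hstep k) (hnonneg k) (hle1 k) hB with hv | ⟨hB', i, hi, hi'⟩
        · obtain ⟨v, hv1, hv2⟩ := hcon k (by omega)
          exact absurd (hv v hv1) (not_le.2 hv2)
        · refine ⟨hB', Nat.succ_le_of_lt (hz.trans_lt (Finset.card_lt_card ?_))⟩
          rw [Finset.ssubset_iff_of_subset]
          · exact ⟨i, by simp [hi'], by simp [hi.ne']⟩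
          · intro j hj
            simp only [Finset.mem_filter, Finset.mem_univ, true_and] at hj ⊢
            have := hanti (Nat.le_succ k) j
            exact le_antisymm (hj ▸ this) (hnonneg _ j)
    have hz := (hind n le_rfl).2
    have hall : ∀ i, W n i = 0 := by
      have : (Finset.univ.filter fun i => W n i = 0) = Finset.univ :=
        Finset.eq_univ_of_card _ (le_antisymm (Finset.card_le_univ _) (by simpa using hz))
      intro i
      have hi := Finset.mem_univ i
      rw [← this] at hi
      exact (Finset.mem_filter.1 hi).2
    have := hrem n
    simp only [hall, sub_zero, Finset.sum_const, Finset.card_univ, Fintype.card_fin,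
      nsmul_eq_mul, mul_one] at this
    nlinarith [h.eps_le]
  have hpos : 0 < ∑ i, W n i := by
    have h1 := hrem n
    simp only [Finset.sum_sub_distrib, Finset.sum_const, Finset.card_univ, Fintype.card_fin,
      nsmul_eq_mul, mul_one] at h1
    nlinarith [h.eps_le]
  have := h.norm_wmean_sub_sq_le (hnonneg n) (hle1 n) (hrem n) (Λ := 42 * Δ) (by positivity)
    fun v hv => (wvar_mono y hpos (hanti hk.le) v).trans (hvar v hv)
  linarith

end Filter

/-! ### Stable sets -/

section Stable

variable {n d : ℕ}

open Matrix in
theorem inner_toEuclideanCLM_subSecondMoment (x : Points n d) (μ v : RVec d) (I : Finset (Fin n))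
    (s : ℝ) : inner ℝ v (toEuclideanCLM (n := Fin d) (𝕜 := ℝ)
      (subSecondMoment x μ I - s • (1 : Matrix (Fin d) (Fin d) ℝ)) v) =
      (I.card : ℝ)⁻¹ * ∑ i ∈ I, inner ℝ v (x i - μ) ^ 2 - s * ‖v‖ ^ 2 := by
  have hvv : v.ofLp ⬝ᵥ v.ofLp = ‖v‖ ^ 2 := by
    rw [← real_inner_self_eq_norm_sq, EuclideanSpace.inner_eq_star_dotProduct, star_trivial]
  rw [inner_toEuclideanCLM, sub_mulVec, dotProduct_sub, smul_mulVec, one_mulVec, dotProduct_smul,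
    hvv, subSecondMoment, smul_mulVec, dotProduct_smul, sum_mulVec, dotProduct_sum, smul_eq_mul,
    smul_eq_mul]
  congr 2
  refine Finset.sum_congr rfl fun i _ => ?_
  rw [vecMulVec_mulVec]
  simp only [EuclideanSpace.inner_eq_star_dotProduct, star_trivial, op_smul_eq_smul,
    dotProduct_smul, smul_eq_mul]
  rw [dotProduct_comm v.ofLp, sq]

theorem IsStable.abs_sum_inner_sq_sub_le {η δ σ : ℝ} {x : Points n d} {μ : RVec d}
    (h : IsStable η δ x μ σ) {I : Finset (Fin n)} (hI : (1 - η) * n ≤ I.card) (hI0 : 0 < I.card)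
    {v : RVec d} (hv : ‖v‖ = 1) :
    |∑ i ∈ I, inner ℝ v (x i - μ) ^ 2 - I.card * σ ^ 2| ≤ I.card * (σ ^ 2 * δ ^ 2 / η) := by
  have h1 := h.secondMoment_close I hI
  rw [matSpectralNorm] at h1
  set M := Matrix.toEuclideanCLM (n := Fin d) (𝕜 := ℝ)
    (subSecondMoment x μ I - σ ^ 2 • (1 : Matrix (Fin d) (Fin d) ℝ)) with hM
  have h2 : |inner ℝ v (M v)| ≤ σ ^ 2 * δ ^ 2 / η := by
    refine (abs_real_inner_le_norm v (M v)).trans ?_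
    have := M.le_opNorm v
    rw [hv, mul_one] at this
    rw [hv, one_mul]
    exact this.trans h1
  rw [hM, inner_toEuclideanCLM_subSecondMoment, hv, one_pow, mul_one] at h2
  have hc : (0 : ℝ) < I.card := by exact_mod_cast hI0
  have h3 := mul_le_mul_of_nonneg_left h2 hc.le
  rw [← abs_of_pos hc, ← abs_mul, abs_of_pos hc, mul_sub, mul_inv_cancel_left₀ hc.ne'] at h3
  exact h3

theorem subMean_univ_eq_wmean (x : Points n d) : subMean x Finset.univ = wmean x fun _ => 1 := by
  simp [subMean, wmean]

open Classical in
-- The tail bound compares stability of the whole set with stability after deleting the largest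
-- terms: the difference of the two second moments is what those terms contribute.
theorem IsStable.robustData {C ε δ σ : ℝ} {S T : Points n d} (hC : 1000 ≤ C) (hn : 0 < n)
    (hT : IsCorruption ε S T) (hS : IsStable (C * ε) δ S (subMean S Finset.univ) σ)
    (h1 : 1 ≤ ε * n) :
    RobustData S T (Finset.univ.filter fun i => T i ≠ S i) (subMean S Finset.univ) ε (σ ^ 2)
      (σ ^ 2 * δ ^ 2 / (C * ε)) := by
  have hC0 : 0 < C := by linarith
  have hη := hS.eps_pos
  have hε : 0 < ε := pos_of_mul_pos_right hη hC0.le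
  have hn' : (0 : ℝ) < n := by exact_mod_cast hn
  have hεC : 1000 * ε ≤ C * ε := mul_le_mul_of_nonneg_right hC hε.le
  set Δ := σ ^ 2 * δ ^ 2 / (C * ε) with hΔ
  have hΔge : σ ^ 2 * (C * ε) ≤ Δ := by
    rw [hΔ, le_div_iff₀ hη, mul_assoc]
    refine mul_le_mul_of_nonneg_left ?_ (sq_nonneg _)
    have := hS.eps_le
    nlinarith
  have hΔ4 : 4 * (σ ^ 2 * ε) ≤ Δ := by nlinarith [sq_nonneg σ]
  have huniv : ∀ v : RVec d, ‖v‖ = 1 →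
      |∑ i, inner ℝ v (S i - subMean S Finset.univ) ^ 2 - n * σ ^ 2| ≤ n * Δ := by
    intro v hv
    have := hS.abs_sum_inner_sq_sub_le (I := Finset.univ) (by
      simp only [Finset.card_univ, Fintype.card_fin]; nlinarith) (by simpa using hn) hv
    simpa only [Finset.card_univ, Fintype.card_fin] using this
  refine ⟨?_, ?_, ?_, ?_, h1, sq_nonneg σ, ?_, ?_, ?_, ?_⟩
  · intro i hi
    simpa using hi
  · rw [IsCorruption] at hT
    convert hT using 2
    rw [← Set.ncard_coe_finset]
    congr 1
    ext i; simp
  · rw [Finset.sum_sub_distrib, subMean]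
    simp only [Finset.sum_const, Finset.card_univ, Fintype.card_fin, ← Nat.cast_smul_eq_nsmul ℝ]
    rw [smul_smul, mul_inv_cancel₀ hn'.ne', one_smul, sub_self]
  · have := hS.eps_lt
    linarith
  · nlinarith [sq_nonneg σ]
  · intro v hv
    have := (abs_le.1 (huniv v hv)).1
    linarith
  · intro v hv
    have := (abs_le.1 (huniv v hv)).2
    linarith
  · intro v hv u hu0 hu1 hu
    set f : Fin n → ℝ := fun i => inner ℝ v (S i - subMean S Finset.univ) ^ 2
    -- Rounding up costs at most one point, so K ≤ 4εn because 1 ≤ εn. As 4 ≤ C, the complement of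
    -- `K` points is still large enough for stability.
    set K := ⌈3 * (ε * n)⌉₊ with hK
    have hK1 : 3 * (ε * n) ≤ K := Nat.le_ceil _
    have hK2 : (K : ℝ) < 3 * (ε * n) + 1 := Nat.ceil_lt_add_one (by positivity)
    have hK3 : (K : ℝ) ≤ 4 * (ε * n) := by linarith
    have hηn : C * ε * n < n / 2 := by nlinarith [hS.eps_lt]
    have hK4 : (K : ℝ) ≤ C * ε * n := by nlinarith
    have hKn : K < n := by
      have : (K : ℝ) < n := by linarith
      exact_mod_cast this
    obtain ⟨L, hLc, htop⟩ := exists_top_finset f K hKn.le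
    have h2 := sum_mul_le_sum_top (fun i => sq_nonneg _) hu0 hu1 htop (by rw [hLc]; linarith)
    have hLcc : Lᶜ.card = n - K := by rw [Finset.card_compl, Fintype.card_fin, hLc]
    have hLcr : (Lᶜ.card : ℝ) = n - K := by rw [hLcc, Nat.cast_sub hKn.le]
    have h3 := (abs_le.1 (hS.abs_sum_inner_sq_sub_le (I := Lᶜ) (by rw [hLcr]; linarith)
      (by omega) hv)).1
    have h4 := (abs_le.1 (huniv v hv)).2
    have h5 := Finset.sum_add_sum_compl L f
    rw [← hΔ, hLcr] at h3
    have hΔ0 : 0 ≤ Δ := le_trans (by positivity) hΔ4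
    have h6 : 0 ≤ K * Δ := by positivity
    have h7 : K * σ ^ 2 ≤ 4 * (ε * n) * σ ^ 2 := mul_le_mul_of_nonneg_right hK3 (sq_nonneg _)
    have h8 := mul_le_mul_of_nonneg_right hΔ4 hn'.le
    change ∑ i, u i * f i ≤ _
    change _ ≤ ∑ i ∈ Lᶜ, f i - _ at h3
    change ∑ i, f i - _ ≤ _ at h4
    linarith

/-- The weighted mean found by the filter is close to the mean of the stable set. -/
theorem norm_subMean_sub_wmean_le {C ε δ σ : ℝ} {S T : Points n d} (hC : 1000 ≤ C) (hn : 0 < n)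
    (hσ : 0 < σ) (hT : IsCorruption ε S T)
    (hS : IsStable (C * ε) δ S (subMean S Finset.univ) σ) {W : ℕ → Fin n → ℝ}
    (h0 : W 0 = fun _ => 1) (hstep : ∀ k, IsFilterStep T (ε * n) (W k) (W (k + 1))) :
    ‖subMean S Finset.univ - wmean T (W n)‖ ≤ σ * δ := by
  have hC0 : 0 < C := by linarith
  have hη := hS.eps_pos
  have hε : 0 < ε := pos_of_mul_pos_right hη hC0.le
  have hn' : (0 : ℝ) < n := by exact_mod_cast hn
  have hδ : 0 ≤ δ := hη.le.trans hS.eps_le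
  rcases le_or_gt 1 (ε * n) with h1 | h1
  · have h2 := (hS.robustData hC hn hT h1).norm_wmean_sub_sq_le_of_filter h0 hstep
    rw [norm_sub_rev]
    refine le_of_sq_le_sq ?_ (by positivity)
    refine h2.trans ?_
    have e : ε * (448 * (σ ^ 2 * δ ^ 2 / (C * ε))) = (448 / C) * (σ * δ) ^ 2 := by
      field_simp
    rw [e]
    exact mul_le_of_le_one_left (sq_nonneg _) ((div_le_one hC0).2 (by linarith))
  -- When εn < 1, no point is corrupted and no weight is lowered, so the output is the exact mean.
  · have hW : ∀ k, W k = fun _ => 1 := by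
      intro k
      induction k with
      | zero => exact h0
      | succ k ih =>
        rw [(hstep k).eq_of_lt_one (by positivity) h1 (by
          have : (1 : ℝ) ≤ n := by exact_mod_cast hn
          linarith), ih]
    have hTS : T = S := by
      rw [IsCorruption] at hT
      have h2 : ({i | T i ≠ S i}.ncard : ℝ) < 1 := hT.trans_lt h1
      have h3 : {i | T i ≠ S i}.ncard = 0 := Nat.lt_one_iff.1 (by exact_mod_cast h2)
      rw [Set.ncard_eq_zero (Set.toFinite _)] at h3
      funext i
      by_contra hi
      exact (Set.eq_empty_iff_forall_notMem.1 h3 i) hi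
    rw [hW, hTS, subMean_univ_eq_wmean, sub_self, norm_zero]
    positivity

end Stable

/-! ### Ranks -/

section Rank

variable {n : ℕ}

/-- `j` comes before `i` when the entries of `a` are listed in decreasing order. -/
def Precedes (a : Fin n → ℝ) (j i : Fin n) : Prop :=
  ¬ (a j ≤ a i ∧ ¬ (a i ≤ a j ∧ (j : ℕ) + 1 ≤ i))

/-- `Precedes` is spelled with negation, conjunction and ≤ to match the machine test. Ties are
broken by index, which makes the order strict and total. -/
theorem precedes_iff {a : Fin n → ℝ} {j i : Fin n} :
    Precedes a j i ↔ a i < a j ∨ a i = a j ∧ j < i := by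
  rw [Precedes, Fin.lt_def]
  constructor
  · intro h
    by_cases h1 : a j ≤ a i
    · have h2 := not_not.1 fun h2 => h ⟨h1, h2⟩
      exact Or.inr ⟨le_antisymm h2.1 h1, h2.2⟩
    · exact Or.inl (not_le.1 h1)
  · rintro (h | ⟨h1, h2⟩) ⟨h3, h4⟩
    · exact absurd h3 (not_le.2 h)
    · exact h4 ⟨h1.le, h2⟩

open Classical in
/-- The number of indices before `i` in decreasing order of `a`. -/
noncomputable def rankOf (a : Fin n → ℝ) (i : Fin n) : ℕ :=
  (Finset.univ.filter fun j => Precedes a j i).card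

theorem rankOf_lt_rankOf {a : Fin n → ℝ} {j i : Fin n} (h : Precedes a j i) :
    rankOf a j < rankOf a i := by
  refine Finset.card_lt_card ((Finset.ssubset_iff_of_subset fun k hk => ?_).2 ⟨j, ?_, ?_⟩)
  · simp only [Finset.mem_filter, Finset.mem_univ, true_and] at hk ⊢
    rw [precedes_iff] at *
    rcases h with h | h <;> rcases hk with hk | hk
    · exact Or.inl (h.trans hk)
    · exact Or.inl (hk.1 ▸ h)
    · exact Or.inl (h.1 ▸ hk)
    · exact Or.inr ⟨h.1.trans hk.1, hk.2.trans h.2⟩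
  · simpa using h
  · simp [precedes_iff]

theorem rankOf_lt (a : Fin n → ℝ) (i : Fin n) : rankOf a i < n := by
  conv_rhs => rw [← Fintype.card_fin n]
  refine Finset.card_lt_univ_of_notMem (x := i) ?_
  simp [precedes_iff]

theorem rankOf_injective (a : Fin n → ℝ) : Function.Injective (rankOf a) := by
  intro i j hij
  by_contra hne
  rcases lt_trichotomy (a i) (a j) with h | h | h
  · exact (rankOf_lt_rankOf (precedes_iff.2 (Or.inl h))).ne' hij
  · rcases lt_or_gt_of_ne hne with h' | h'
    · exact (rankOf_lt_rankOf (precedes_iff.2 (Or.inr ⟨h.symm, h'⟩))).ne hij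
    · exact (rankOf_lt_rankOf (precedes_iff.2 (Or.inr ⟨h, h'⟩))).ne' hij
  · exact (rankOf_lt_rankOf (precedes_iff.2 (Or.inl h))).ne hij

open Classical in
/-- The `⌊τ⌋` indices with the largest entries. -/
noncomputable def topSet (a : Fin n → ℝ) (τ : ℝ) : Finset (Fin n) :=
  Finset.univ.filter fun i => (rankOf a i : ℝ) + 1 ≤ τ

theorem mem_topSet {a : Fin n → ℝ} {τ : ℝ} {i : Fin n} :
    i ∈ topSet a τ ↔ (rankOf a i : ℝ) + 1 ≤ τ := by simp [topSet]

theorem le_of_mem_topSet {a : Fin n → ℝ} {τ : ℝ} {i j : Fin n} (hi : i ∈ topSet a τ)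
    (hj : j ∉ topSet a τ) : a j ≤ a i := by
  rw [mem_topSet] at hi hj
  by_contra! h
  have h1 : (rankOf a j : ℝ) < rankOf a i := by
    exact_mod_cast rankOf_lt_rankOf (precedes_iff.2 (Or.inl h))
  linarith

/-- Ranks are a bijection onto 0, …, n - 1, and r + 1 ≤ τ holds exactly for the naturals r < ⌊τ⌋. A
comparison thus replaces rounding. -/
theorem card_topSet (a : Fin n → ℝ) {τ : ℝ} (h0 : 0 ≤ τ) (hn : τ ≤ n) :
    (topSet a τ).card = ⌊τ⌋₊ := by
  have himg : Finset.univ.image (rankOf a) = Finset.range n :=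
    Finset.eq_of_subset_of_card_le
      (fun r hr => by
        obtain ⟨i, -, rfl⟩ := Finset.mem_image.1 hr
        exact Finset.mem_range.2 (rankOf_lt a i))
      (by rw [Finset.card_image_of_injective _ (rankOf_injective a)]; simp)
  have hfl : ⌊τ⌋₊ ≤ n := Nat.floor_le_of_le hn
  have : (topSet a τ).image (rankOf a) = Finset.range ⌊τ⌋₊ := by
    ext r
    simp only [Finset.mem_image, mem_topSet, Finset.mem_range]
    constructor
    · rintro ⟨i, hi, rfl⟩
      exact Nat.succ_le_iff.1 ((Nat.le_floor_iff h0).2 (by exact_mod_cast hi))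
    · intro hr
      have : r ∈ Finset.univ.image (rankOf a) := by
        rw [himg]; exact Finset.mem_range.2 (by omega)
      obtain ⟨i, -, rfl⟩ := Finset.mem_image.1 this
      refine ⟨i, ?_, rfl⟩
      have := (Nat.le_floor_iff h0).1 (Nat.succ_le_iff.2 hr)
      exact_mod_cast this
  rw [← Finset.card_range ⌊τ⌋₊, ← this, Finset.card_image_of_injective _ (rankOf_injective a)]

end Rank

/-! ### The program -/

namespace RealRAM

theorem computes_sum (a : ℕ) {N M L : NExp} {N' M' L' : ℕ → ℕ → ℕ} {b : Test} {e₁ e₂ : RExp}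
    (hN : IsSize N N') (hM : IsSize M M') (hL : IsSize L L')
    (p : Mem → ℕ → ℕ → ℕ → Prop) (t₁ t₂ : Mem → ℕ → ℕ → ℕ → ℝ)
    (hp : ∀ s : Store, b.Holds s ↔ p s.real (s.nat 2) (s.nat 3) (s.nat 4))
    (h₁ : ∀ s : Store, e₁.eval s = t₁ s.real (s.nat 2) (s.nat 3) (s.nat 4))
    (h₂ : ∀ s : Store, e₂.eval s = t₂ s.real (s.nat 2) (s.nat 3) (s.nat 4))
    (hcongr : ∀ R R' : Mem, (∀ a', a' ≠ a → R a' = R' a') →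
      p R = p R' ∧ t₁ R = t₁ R' ∧ t₂ R = t₂ R') :
    Computes 5 (tabulate a N M L b (.add (.get a (.reg 2) (.reg 3)) e₁)
        (.add (.get a (.reg 2) (.reg 3)) e₂))
      (fun n d R => overwrite a (N' n d) (M' n d) (fun i j =>
        ∑ l ∈ Finset.range (L' n d), pick (p R i j l) (t₁ R i j l) (t₂ R i j l)) R) := by
  have h := computes_tabulate a (b := b) (e₁ := .add (.get a (.reg 2) (.reg 3)) e₁)
    (e₂ := .add (.get a (.reg 2) (.reg 3)) e₂) hN hM hL
    (fun R i j l acc => acc + pick (p R i j l) (t₁ R i j l) (t₂ R i j l))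
    (by
      intro s
      rw [propext (hp s)]
      simp only [RExp.eval, NExp.eval, h₁, h₂, pick]
      split_ifs <;> rfl)
    (by
      intro R R' hR
      obtain ⟨k1, k2, k3⟩ := hcongr R R' hR
      simp only [k1, k2, k3])
  simpa only [foldVal_add] using h

/-- Sums without case distinction. -/
def tabulateSum (a : ℕ) (N M L : NExp) (e : RExp) : Prog :=
  tabulate a N M L (.natLe (.lit 0) (.lit 0)) (.add (.get a (.reg 2) (.reg 3)) e)
    (.add (.get a (.reg 2) (.reg 3)) e)

theorem computes_tabulateSum (a : ℕ) {N M L : NExp} {N' M' L' : ℕ → ℕ → ℕ} {e : RExp}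
    (hN : IsSize N N') (hM : IsSize M M') (hL : IsSize L L') (t : Mem → ℕ → ℕ → ℕ → ℝ)
    (h : ∀ s : Store, e.eval s = t s.real (s.nat 2) (s.nat 3) (s.nat 4))
    (hcongr : ∀ R R' : Mem, (∀ a', a' ≠ a → R a' = R' a') → t R = t R') :
    Computes 5 (tabulateSum a N M L e)
      (fun n d R => overwrite a (N' n d) (M' n d) (fun i j =>
        ∑ l ∈ Finset.range (L' n d), t R i j l) R) := by
  have h := computes_sum a (b := .natLe (.lit 0) (.lit 0)) hN hM hL (fun _ _ _ _ => True) t t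
    (fun s => by simp [Test.Holds, NExp.eval]) h h (fun R R' hR => ⟨rfl, hcongr R R' hR, hcongr R R' hR⟩)
  simpa only [tabulateSum, pick, if_true] using h

/-- Entry `(i, j)` of array `a`, for loop variables `i`, `j`. -/
abbrev entry (a i j : ℕ) : RExp := .get a (.reg i) (.reg j)

/-- Entry `(i, 0)` of array `a`, for a loop variable `i`. -/
abbrev coordinate (a i : ℕ) : RExp := .get a (.reg i) (.lit 0)

/-- Entry `(0, 0)` of array `a`. -/
abbrev scalar (a : ℕ) : RExp := .get a (.lit 0) (.lit 0)

/-- Coordinate `j` of point `i`, centered. -/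
abbrev centeredEntry (i j : ℕ) : RExp :=
  .sub (.get 0 (.reg i) (.reg j)) (.get 2 (.lit 0) (.reg j))

/-- Array `12` receives the total weight, array `2` the weighted mean. -/
def meanProg : Prog :=
  .seq (tabulateSum 12 (.lit 1) (.lit 1) (.reg 0) (coordinate 3 4))
    (tabulateSum 2 (.lit 1) (.reg 1) (.reg 0)
      (.div (.mul (coordinate 3 4) (entry 0 4 3)) (scalar 12)))

noncomputable def meanMem (n d : ℕ) (R : Mem) : Mem :=
  let R₁ := overwrite 12 1 1 (fun _ _ => ∑ l ∈ Finset.range n, R 3 l 0) R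
  overwrite 2 1 d (fun _ j => ∑ l ∈ Finset.range n, R₁ 3 l 0 * R₁ 0 l j / R₁ 12 0 0) R₁

theorem computes_meanProg : Computes 5 meanProg meanMem :=
  (computes_tabulateSum 12 isSize_one isSize_one isSize_points (fun R _ _ l => R 3 l 0)
    (fun _ => rfl) (fun R R' h => by simp [h])).seq
  (computes_tabulateSum 2 isSize_one isSize_dim isSize_points
    (fun R _ j l => R 3 l 0 * R 0 l j / R 12 0 0)
    (fun _ => rfl) (fun R R' h => by simp [h]))

/-- Array `4` receives the scatter matrix. -/
def scatterProg : Prog :=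
  tabulateSum 4 (.reg 1) (.reg 1) (.reg 0)
    (.mul (coordinate 3 4) (.mul (centeredEntry 4 2) (centeredEntry 4 3)))

noncomputable def scatterMem (n d : ℕ) (R : Mem) : Mem :=
  overwrite 4 d d (fun i j => ∑ l ∈ Finset.range n,
    R 3 l 0 * ((R 0 l i - R 2 0 i) * (R 0 l j - R 2 0 j))) R

theorem computes_scatterProg : Computes 5 scatterProg scatterMem :=
  computes_tabulateSum 4 isSize_dim isSize_dim isSize_points
    (fun R i j l => R 3 l 0 * ((R 0 l i - R 2 0 i) * (R 0 l j - R 2 0 j)))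
    (fun _ => rfl) (fun R R' h => by simp [h])

/-- The matrix in array `4` is squared. -/
def squareProg : Prog :=
  .seq (tabulateSum 5 (.reg 1) (.reg 1) (.reg 1) (.mul (entry 4 2 4) (entry 4 4 3)))
    (tabulateSum 4 (.reg 1) (.reg 1) (.lit 1) (entry 5 2 3))

/-- A table is destroyed cell by cell while it is rebuilt, so the product is formed in array `5` and
copied back as a sum of length one. -/
noncomputable def squareMem (_n d : ℕ) (R : Mem) : Mem :=
  let R₁ := overwrite 5 d d (fun i j => ∑ l ∈ Finset.range d, R 4 i l * R 4 l j) R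
  overwrite 4 d d (fun i j => ∑ _l ∈ Finset.range 1, R₁ 5 i j) R₁

theorem computes_squareProg : Computes 5 squareProg squareMem :=
  (computes_tabulateSum 5 isSize_dim isSize_dim isSize_dim (fun R i j l => R 4 i l * R 4 l j)
    (fun _ => rfl) (fun R R' h => by simp [h])).seq
  (computes_tabulateSum 4 isSize_dim isSize_dim isSize_one (fun R i j _ => R 5 i j)
    (fun _ => rfl) (fun R R' h => by simp [h]))

/-- Array `6` receives the values of the quadratic form of array `4` at the centered points. -/
def scoreProg : Prog :=
  .seq (tabulateSum 13 (.reg 0) (.reg 1) (.reg 1) (.mul (entry 4 3 4) (centeredEntry 2 4)))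
    (tabulateSum 6 (.reg 0) (.lit 1) (.reg 1) (.mul (centeredEntry 2 4) (entry 13 2 4)))

noncomputable def scoreMem (n d : ℕ) (R : Mem) : Mem :=
  let R₁ := overwrite 13 n d (fun i j => ∑ l ∈ Finset.range d,
    R 4 j l * (R 0 i l - R 2 0 l)) R
  overwrite 6 n 1 (fun i _ => ∑ l ∈ Finset.range d, (R₁ 0 i l - R₁ 2 0 l) * R₁ 13 i l) R₁

theorem computes_scoreProg : Computes 5 scoreProg scoreMem :=
  (computes_tabulateSum 13 isSize_points isSize_dim isSize_dim
    (fun R i j l => R 4 j l * (R 0 i l - R 2 0 l))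
    (fun _ => rfl) (fun R R' h => by simp [h])).seq
  (computes_tabulateSum 6 isSize_points isSize_one isSize_dim
    (fun R i _ l => (R 0 i l - R 2 0 l) * R 13 i l)
    (fun _ => rfl) (fun R R' h => by simp [h]))

/-- The weighted score of point `i`. -/
abbrev weightedScore (i : ℕ) : RExp := .mul (coordinate 3 i) (coordinate 6 i)

/-- Array `7` receives the ranks of the weighted scores. -/
def rankProg : Prog :=
  tabulate 7 (.reg 0) (.lit 1) (.reg 0)
    (.not (.and (.realLe (weightedScore 4) (weightedScore 2))
      (.not (.and (.realLe (weightedScore 2) (weightedScore 4))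
        (.natLe (.add (.reg 4) (.lit 1)) (.reg 2))))))
    (.add (entry 7 2 3) (.lit 1)) (.add (entry 7 2 3) (.lit 0))

noncomputable def rankMem (n _d : ℕ) (R : Mem) : Mem :=
  overwrite 7 n 1 (fun i _ => ∑ l ∈ Finset.range n,
    pick (¬ (R 3 l 0 * R 6 l 0 ≤ R 3 i 0 * R 6 i 0 ∧
      ¬ (R 3 i 0 * R 6 i 0 ≤ R 3 l 0 * R 6 l 0 ∧ l + 1 ≤ i))) ((1 : ℚ) : ℝ) ((0 : ℚ) : ℝ)) R

theorem computes_rankProg : Computes 5 rankProg rankMem :=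
  computes_sum 7 isSize_points isSize_one isSize_points
    (fun R i _ l => ¬ (R 3 l 0 * R 6 l 0 ≤ R 3 i 0 * R 6 i 0 ∧
      ¬ (R 3 i 0 * R 6 i 0 ≤ R 3 l 0 * R 6 l 0 ∧ l + 1 ≤ i)))
    (fun _ _ _ _ => ((1 : ℚ) : ℝ)) (fun _ _ _ _ => ((0 : ℚ) : ℝ))
    (fun _ => Iff.rfl) (fun _ => rfl) (fun _ => rfl) (fun R R' h => by simp [h])

/-- Test whether the rank of point `i` is among the `⌊ε n⌋` smallest. -/
abbrev isTop (i : ℕ) : Test :=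
  .realLe (.add (coordinate 7 i) (.lit 1)) (.mul (scalar 1) (scalar 11))

/-- Array `8` receives the largest score of a top point of positive weight. -/
def maxProg : Prog :=
  tabulate 8 (.lit 1) (.lit 1) (.reg 0)
    (.and (.and (isTop 4) (.not (.realLe (coordinate 3 4) (.lit 0))))
      (.realLe (entry 8 2 3) (coordinate 6 4)))
    (coordinate 6 4) (entry 8 2 3)

noncomputable def maxMem (n _d : ℕ) (R : Mem) : Mem :=
  overwrite 8 1 1 (fun _ _ => foldVal (fun l acc =>
    pick ((R 7 l 0 + ((1 : ℚ) : ℝ) ≤ R 1 0 0 * R 11 0 0 ∧ ¬ R 3 l 0 ≤ ((0 : ℚ) : ℝ)) ∧ acc ≤ R 6 l 0)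
      (R 6 l 0) acc) n) R

theorem computes_maxProg : Computes 5 maxProg maxMem :=
  computes_tabulate 8 isSize_one isSize_one isSize_points
    (fun R _ _ l acc =>
      pick ((R 7 l 0 + ((1 : ℚ) : ℝ) ≤ R 1 0 0 * R 11 0 0 ∧ ¬ R 3 l 0 ≤ ((0 : ℚ) : ℝ)) ∧ acc ≤ R 6 l 0)
        (R 6 l 0) acc)
    (fun _ => rfl) (fun R R' h => by simp [h])

/-- Array `9` receives the lowered weights, array `10` the total weight removed. -/
def lowerProg : Prog :=
  .seq (tabulate 9 (.reg 0) (.lit 1) (.lit 1) (isTop 2)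
      (.add (entry 9 2 3) (.sub (coordinate 3 2)
        (.div (.mul (coordinate 3 2) (coordinate 6 2)) (scalar 8))))
      (.add (entry 9 2 3) (coordinate 3 2)))
    (tabulateSum 10 (.lit 1) (.lit 1) (.reg 0) (.sub (.lit 1) (coordinate 9 4)))

noncomputable def lowerMem (n _d : ℕ) (R : Mem) : Mem :=
  let R₁ := overwrite 9 n 1 (fun i _ => ∑ _l ∈ Finset.range 1,
    pick (R 7 i 0 + ((1 : ℚ) : ℝ) ≤ R 1 0 0 * R 11 0 0)
      (R 3 i 0 - R 3 i 0 * R 6 i 0 / R 8 0 0) (R 3 i 0)) R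
  overwrite 10 1 1 (fun _ _ => ∑ l ∈ Finset.range n, (((1 : ℚ) : ℝ) - R₁ 9 l 0)) R₁

theorem computes_lowerProg : Computes 5 lowerProg lowerMem :=
  (computes_sum 9 isSize_points isSize_one isSize_one
    (fun R i _ _ => R 7 i 0 + ((1 : ℚ) : ℝ) ≤ R 1 0 0 * R 11 0 0)
    (fun R i _ _ => R 3 i 0 - R 3 i 0 * R 6 i 0 / R 8 0 0) (fun R i _ _ => R 3 i 0)
    (fun _ => Iff.rfl) (fun _ => rfl) (fun _ => rfl) (fun R R' h => by simp [h])).seq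
  (computes_tabulateSum 10 isSize_one isSize_one isSize_points
    (fun R _ _ l => ((1 : ℚ) : ℝ) - R 9 l 0)
    (fun _ => rfl) (fun R R' h => by simp [h]))

/-- The lowered weights are adopted unless too much weight has been removed. -/
def acceptProg : Prog :=
  .seq (tabulate 14 (.reg 0) (.lit 1) (.lit 1)
      (.realLe (scalar 10) (.mul (.lit 2) (.mul (scalar 1) (scalar 11))))
      (.add (entry 14 2 3) (coordinate 9 2)) (.add (entry 14 2 3) (coordinate 3 2)))
    (tabulateSum 3 (.reg 0) (.lit 1) (.lit 1) (coordinate 14 2))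

noncomputable def acceptMem (n _d : ℕ) (R : Mem) : Mem :=
  let R₁ := overwrite 14 n 1 (fun i _ => ∑ _l ∈ Finset.range 1,
    pick (R 10 0 0 ≤ ((2 : ℚ) : ℝ) * (R 1 0 0 * R 11 0 0)) (R 9 i 0) (R 3 i 0)) R
  overwrite 3 n 1 (fun i _ => ∑ _l ∈ Finset.range 1, R₁ 14 i 0) R₁

theorem computes_acceptProg : Computes 5 acceptProg acceptMem :=
  (computes_sum 14 isSize_points isSize_one isSize_one
    (fun R _ _ _ => R 10 0 0 ≤ ((2 : ℚ) : ℝ) * (R 1 0 0 * R 11 0 0))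
    (fun R i _ _ => R 9 i 0) (fun R i _ _ => R 3 i 0)
    (fun _ => Iff.rfl) (fun _ => rfl) (fun _ => rfl) (fun R R' h => by simp [h])).seq
  (computes_tabulateSum 3 isSize_points isSize_one isSize_one
    (fun R i _ _ => R 14 i 0)
    (fun _ => rfl) (fun R R' h => by simp [h]))

/-- Array `11` receives the number of points, and all weights are set to one. -/
def initProg : Prog :=
  .seq (tabulateSum 11 (.lit 1) (.lit 1) (.reg 0) (.lit 1))
    (tabulateSum 3 (.reg 0) (.lit 1) (.lit 1) (.lit 1))

noncomputable def initMem (n _d : ℕ) (R : Mem) : Mem :=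
  overwrite 3 n 1 (fun _ _ => ∑ _l ∈ Finset.range 1, ((1 : ℚ) : ℝ))
    (overwrite 11 1 1 (fun _ _ => ∑ _l ∈ Finset.range n, ((1 : ℚ) : ℝ)) R)

theorem computes_initProg : Computes 5 initProg initMem :=
  (computes_tabulateSum 11 isSize_one isSize_one isSize_points
    (fun _ _ _ _ => ((1 : ℚ) : ℝ)) (fun _ => rfl) (fun _ _ _ => rfl)).seq
  (computes_tabulateSum 3 isSize_points isSize_one isSize_one
    (fun _ _ _ _ => ((1 : ℚ) : ℝ)) (fun _ => rfl) (fun _ _ _ => rfl))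

/-- One step of the filter. -/
def stepProg : Prog :=
  .seq (.seq (.seq (.seq (.seq (.seq (.seq meanProg scatterProg)
    (forLoop 5 (.add (.reg 0) (.reg 1)) squareProg)) scoreProg) rankProg) maxProg) lowerProg)
    acceptProg

noncomputable def stepMem (n d : ℕ) (R : Mem) : Mem :=
  acceptMem n d (lowerMem n d (maxMem n d (rankMem n d (scoreMem n d
    ((squareMem n d)^[n + d] (scatterMem n d (meanMem n d R)))))))

theorem computes_stepProg : Computes 6 stepProg stepMem := by
  have h56 : 5 ≤ 6 := by omega
  exact ((((((((computes_meanProg.mono h56).seq (computes_scatterProg.mono h56)).seq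
    (computes_squareProg.repeat (by omega) isSize_add)).seq (computes_scoreProg.mono h56)).seq
    (computes_rankProg.mono h56)).seq (computes_maxProg.mono h56)).seq
    (computes_lowerProg.mono h56)).seq (computes_acceptProg.mono h56))

/-- The robust mean estimation program. -/
def filterProg : Prog :=
  .seq (.seq initProg (forLoop 6 (.reg 0) stepProg)) meanProg

noncomputable def filterMem (n d : ℕ) (R : Mem) : Mem :=
  meanMem n d ((stepMem n d)^[n] (initMem n d R))

theorem computes_filterProg : Computes 7 filterProg filterMem :=
  ((computes_initProg.mono (by omega)).seq
    (computes_stepProg.repeat (by omega) isSize_points)).seq (computes_meanProg.mono (by omega))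

end RealRAM

/-! ### Correctness of the program -/

namespace RealRAM

variable {n d : ℕ}

/-- The memory holds the points `y`, the parameter `ε`, the number `n` and the weights `w`. -/
structure Represents (y : Points n d) (ε : ℝ) (w : Fin n → ℝ) (R : Mem) : Prop where
  points : ∀ (i : Fin n) (j : Fin d), R 0 i j = y i j
  eps : R 1 0 0 = ε
  count : R 11 0 0 = n
  weights : ∀ i : Fin n, R 3 i 0 = w i

theorem Represents.of_eq {y : Points n d} {ε : ℝ} {w : Fin n → ℝ} {R R' : Mem}
    (h : Represents y ε w R) (h0 : R' 0 = R 0) (h1 : R' 1 = R 1) (h11 : R' 11 = R 11)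
    (h3 : R' 3 = R 3) : Represents y ε w R' :=
  ⟨fun i j => h0 ▸ h.points i j, h1 ▸ h.eps, h11 ▸ h.count, fun i => h3 ▸ h.weights i⟩

theorem Represents.meanMem {y : Points n d} {ε : ℝ} {w : Fin n → ℝ} {R : Mem}
    (h : Represents y ε w R) :
    Represents y ε w (meanMem n d R) ∧ ∀ j : Fin d, meanMem n d R 2 0 j = wmean y w j := by
  have e : ∀ a, a ≠ 2 → a ≠ 12 → RealRAM.meanMem n d R a = R a := fun a h2 h12 => by
    rw [RealRAM.meanMem, overwrite_of_ne h2, overwrite_of_ne h12]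
  refine ⟨h.of_eq (e 0 (by decide) (by decide)) (e 1 (by decide) (by decide))
    (e 11 (by decide) (by decide)) (e 3 (by decide) (by decide)), fun j => ?_⟩
  rw [RealRAM.meanMem, overwrite_self one_pos j.2, overwrite_of_ne (by decide : 3 ≠ 12),
    overwrite_of_ne (by decide : 0 ≠ 12), overwrite_self one_pos one_pos, Finset.sum_range,
    Finset.sum_range]
  simp only [h.weights, h.points, wmean]
  simp [Finset.mul_sum, div_eq_inv_mul]

theorem Represents.scatterMem {y : Points n d} {ε : ℝ} {w : Fin n → ℝ} {R : Mem}
    (h : Represents y ε w R) (hμ : ∀ j : Fin d, R 2 0 j = wmean y w j) (i j : Fin d) :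
    scatterMem n d R 4 i j = scatter y w i j := by
  rw [RealRAM.scatterMem, overwrite_self i.2 j.2, Finset.sum_range]
  simp only [h.weights, h.points, hμ, scatter, Matrix.sum_apply, Matrix.smul_apply,
    Matrix.vecMulVec_apply, smul_eq_mul, PiLp.sub_apply]

theorem squareMem_of_ne {R : Mem} {a : ℕ} (h4 : a ≠ 4) (h5 : a ≠ 5) :
    squareMem n d R a = R a := by
  rw [squareMem, overwrite_of_ne h4, overwrite_of_ne h5]

theorem iterate_squareMem_of_ne {R : Mem} {a : ℕ} (h4 : a ≠ 4) (h5 : a ≠ 5) (k : ℕ) :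
    (squareMem n d)^[k] R a = R a := by
  induction k with
  | zero => rfl
  | succ k ih => rw [Function.iterate_succ_apply', squareMem_of_ne h4 h5, ih]

theorem iterate_squareMem {R : Mem} {A : Matrix (Fin d) (Fin d) ℝ}
    (hA : ∀ i j : Fin d, R 4 i j = A i j) (k : ℕ) (i j : Fin d) :
    (squareMem n d)^[k] R 4 i j = (A ^ 2 ^ k) i j := by
  induction k generalizing i j with
  | zero => rw [pow_zero, pow_one]; exact hA i j
  | succ k ih =>
    rw [Function.iterate_succ_apply', squareMem, overwrite_self i.2 j.2, Finset.sum_range_one,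
      overwrite_self i.2 j.2, Finset.sum_range, pow_succ, pow_mul, pow_two, Matrix.mul_apply]
    simp only [ih]

theorem Represents.scoreMem {y : Points n d} {ε : ℝ} {w : Fin n → ℝ} {R : Mem}
    (h : Represents y ε w R) (hμ : ∀ j : Fin d, R 2 0 j = wmean y w j)
    (hA : ∀ i j : Fin d, R 4 i j = (scatter y w ^ 2 ^ (n + d)) i j) (i : Fin n) :
    scoreMem n d R 6 i 0 = outlierScore y w i := by
  rw [RealRAM.scoreMem, overwrite_self i.2 one_pos, overwrite_of_ne (by decide : 0 ≠ 13),
    overwrite_of_ne (by decide : 2 ≠ 13), Finset.sum_range, outlierScore, dotProduct]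
  refine Finset.sum_congr rfl fun l _ => ?_
  rw [overwrite_self i.2 l.2, Finset.sum_range, h.points, hμ, Matrix.mulVec, dotProduct]
  simp only [hA, h.points, hμ, PiLp.sub_apply]

theorem rankMem_apply {R : Mem} {a : Fin n → ℝ} (ha : ∀ i : Fin n, R 3 i 0 * R 6 i 0 = a i)
    (i : Fin n) : rankMem n d R 7 i 0 = rankOf a i := by
  classical
  rw [rankMem, overwrite_self i.2 one_pos, Finset.sum_range, rankOf, Finset.card_filter]
  push_cast
  refine Finset.sum_congr rfl fun l _ => ?_
  rw [ha, ha, pick_eq_ite, Precedes]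
  congr

/-- A running maximum started at the default 0, which explains the alternative. If the filter
obtains c = 0, division by zero yields zero and no weight changes. -/
theorem foldVal_max (p : ℕ → Prop) (g : ℕ → ℝ) (l : ℕ) :
    (∀ i < l, p i → g i ≤ foldVal (fun k acc => pick (p k ∧ acc ≤ g k) (g k) acc) l) ∧
      (foldVal (fun k acc => pick (p k ∧ acc ≤ g k) (g k) acc) l = 0 ∨
        ∃ i < l, p i ∧ g i = foldVal (fun k acc => pick (p k ∧ acc ≤ g k) (g k) acc) l) := by
  classical
  induction l with
  | zero => exact ⟨fun i hi => absurd hi (Nat.not_lt_zero i), Or.inl rfl⟩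
  | succ l ih =>
    obtain ⟨h1, h2⟩ := ih
    rw [foldVal]
    set m := foldVal (fun k acc => pick (p k ∧ acc ≤ g k) (g k) acc) l
    rw [pick_eq_ite]
    split_ifs with h
    · refine ⟨fun i hi hp => ?_, Or.inr ⟨l, Nat.lt_succ_self l, h.1, rfl⟩⟩
      rcases Nat.lt_succ_iff_lt_or_eq.1 hi with hi | rfl
      · exact (h1 i hi hp).trans h.2
      · exact le_rfl
    · refine ⟨fun i hi hp => ?_, ?_⟩
      · rcases Nat.lt_succ_iff_lt_or_eq.1 hi with hi | rfl
        · exact h1 i hi hp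
        · exact (not_le.1 fun hle => h ⟨hp, hle⟩).le
      · rcases h2 with h2 | ⟨i, hi, h2⟩
        · exact Or.inl h2
        · exact Or.inr ⟨i, hi.trans (Nat.lt_succ_self l), h2⟩

/-- The step program performs a step of the filter. -/
theorem Represents.stepMem {y : Points n d} {ε : ℝ} {w : Fin n → ℝ} {R : Mem}
    (h : Represents y ε w R) :
    ∃ w', IsFilterStep y (ε * n) w w' ∧ Represents y ε w' (stepMem n d R) := by
  classical
  obtain ⟨hR₁, hμ₁⟩ := h.meanMem
  set R₁ := RealRAM.meanMem n d R
  have hA₂ := hR₁.scatterMem hμ₁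
  set R₂ := RealRAM.scatterMem n d R₁ with hR₂
  have e₂ : ∀ a, a ≠ 4 → R₂ a = R₁ a := fun a ha => overwrite_of_ne ha
  have hA₃ := iterate_squareMem (n := n) hA₂ (n + d)
  set R₃ := (squareMem n d)^[n + d] R₂ with hR₃
  have e₃ : ∀ a, a ≠ 4 → a ≠ 5 → R₃ a = R₁ a := fun a ha ha' => by
    rw [hR₃, iterate_squareMem_of_ne ha ha', e₂ a ha]
  have hrep₃ : Represents y ε w R₃ := hR₁.of_eq (e₃ 0 (by decide) (by decide))
    (e₃ 1 (by decide) (by decide)) (e₃ 11 (by decide) (by decide)) (e₃ 3 (by decide) (by decide))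
  have hμ₃ : ∀ j : Fin d, R₃ 2 0 j = wmean y w j := fun j => by
    rw [e₃ 2 (by decide) (by decide), hμ₁]
  have hg₄ := hrep₃.scoreMem hμ₃ hA₃
  set R₄ := RealRAM.scoreMem n d R₃ with hR₄
  have e₄ : ∀ a, a ≠ 6 → a ≠ 13 → R₄ a = R₃ a := fun a ha ha' => by
    rw [hR₄, RealRAM.scoreMem, overwrite_of_ne ha, overwrite_of_ne ha']
  have hrep₄ : Represents y ε w R₄ := hrep₃.of_eq (e₄ 0 (by decide) (by decide))
    (e₄ 1 (by decide) (by decide)) (e₄ 11 (by decide) (by decide)) (e₄ 3 (by decide) (by decide))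
  set g := outlierScore y w with hg
  set a : Fin n → ℝ := fun i => w i * g i with ha
  have hr₅ : ∀ i : Fin n, rankMem n d R₄ 7 i 0 = rankOf a i :=
    rankMem_apply fun i => by rw [hrep₄.weights, hg₄]
  set R₅ := rankMem n d R₄ with hR₅
  have e₅ : ∀ b, b ≠ 7 → R₅ b = R₄ b := fun b hb => overwrite_of_ne hb
  have hrep₅ : Represents y ε w R₅ := hrep₄.of_eq (e₅ 0 (by decide)) (e₅ 1 (by decide))
    (e₅ 11 (by decide)) (e₅ 3 (by decide))
  have hg₅ : ∀ i : Fin n, R₅ 6 i 0 = g i := fun i => by rw [e₅ 6 (by decide), hg₄]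
  set L := topSet a (ε * n) with hL
  have hmem : ∀ i : Fin n, R₅ 7 i 0 + ((1 : ℚ) : ℝ) ≤ R₅ 1 0 0 * R₅ 11 0 0 ↔ i ∈ L := by
    intro i
    rw [hr₅, hrep₅.eps, hrep₅.count, hL, mem_topSet, Rat.cast_one]
  set R₆ := maxMem n d R₅ with hR₆
  have e₆ : ∀ b, b ≠ 8 → R₆ b = R₅ b := fun b hb => overwrite_of_ne hb
  have hrep₆ : Represents y ε w R₆ := hrep₅.of_eq (e₆ 0 (by decide)) (e₆ 1 (by decide))
    (e₆ 11 (by decide)) (e₆ 3 (by decide))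
  set c := R₆ 8 0 0 with hc
  obtain ⟨hc₁, hc₂⟩ : (∀ i ∈ L, 0 < w i → g i ≤ c) ∧ (c = 0 ∨ ∃ i ∈ L, 0 < w i ∧ g i = c) := by
    have hfold := foldVal_max
      (fun l => R₅ 7 l 0 + ((1 : ℚ) : ℝ) ≤ R₅ 1 0 0 * R₅ 11 0 0 ∧ ¬ R₅ 3 l 0 ≤ ((0 : ℚ) : ℝ))
      (fun l => R₅ 6 l 0) n
    have hcf : c = foldVal (fun l acc =>
        pick ((R₅ 7 l 0 + ((1 : ℚ) : ℝ) ≤ R₅ 1 0 0 * R₅ 11 0 0 ∧ ¬ R₅ 3 l 0 ≤ ((0 : ℚ) : ℝ)) ∧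
          acc ≤ R₅ 6 l 0) (R₅ 6 l 0) acc) n := by
      rw [hc, hR₆, maxMem, overwrite_self one_pos one_pos]
    rw [← hcf] at hfold
    have hcond : ∀ i : Fin n, (R₅ 7 i 0 + ((1 : ℚ) : ℝ) ≤ R₅ 1 0 0 * R₅ 11 0 0 ∧
        ¬ R₅ 3 i 0 ≤ ((0 : ℚ) : ℝ)) ↔ i ∈ L ∧ 0 < w i := fun i => by
      rw [hmem, hrep₅.weights, Rat.cast_zero, not_le]
    refine ⟨fun i hi hwi => ?_, hfold.2.imp_right ?_⟩
    · rw [← hg₅]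
      exact hfold.1 i i.2 ((hcond i).2 ⟨hi, hwi⟩)
    · rintro ⟨i, hi, hp, hgi⟩
      have hp' := (hcond ⟨i, hi⟩).1 hp
      exact ⟨⟨i, hi⟩, hp'.1, hp'.2, by rw [← hg₅]; exact hgi⟩
  set R₇ := lowerMem n d R₆ with hR₇
  have e₇ : ∀ b, b ≠ 9 → b ≠ 10 → R₇ b = R₆ b := fun b hb hb' => by
    rw [hR₇, lowerMem, overwrite_of_ne hb', overwrite_of_ne hb]
  have hrep₇ : Represents y ε w R₇ := hrep₆.of_eq (e₇ 0 (by decide) (by decide))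
    (e₇ 1 (by decide) (by decide)) (e₇ 11 (by decide) (by decide)) (e₇ 3 (by decide) (by decide))
  set u := downweight w g L c with hu
  have hlow : ∀ i : Fin n, pick (R₆ 7 i 0 + ((1 : ℚ) : ℝ) ≤ R₆ 1 0 0 * R₆ 11 0 0)
      (R₆ 3 i 0 - R₆ 3 i 0 * R₆ 6 i 0 / R₆ 8 0 0) (R₆ 3 i 0) = u i := by
    intro i
    rw [e₆ 7 (by decide), e₆ 1 (by decide), e₆ 11 (by decide), propext (hmem i),
      e₆ 3 (by decide), e₆ 6 (by decide), hrep₅.weights, hg₅, pick_eq_ite, hu, downweight]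
  have hu₇ : ∀ i : Fin n, R₇ 9 i 0 = u i := by
    intro i
    rw [hR₇, lowerMem, overwrite_of_ne (by decide), overwrite_self i.2 one_pos,
      Finset.sum_range_one, hlow]
  have hsum₇ : R₇ 10 0 0 = ∑ i, (1 - u i) := by
    rw [hR₇, lowerMem, overwrite_self one_pos one_pos, Finset.sum_range]
    refine Finset.sum_congr rfl fun i _ => ?_
    rw [overwrite_self i.2 one_pos, Finset.sum_range_one, hlow, Rat.cast_one]
  refine ⟨if ∑ i, (1 - u i) ≤ 2 * (ε * n) then u else w,
    ⟨L, c, fun i hi j hj => le_of_mem_topSet hi hj, fun h0 hn => ?_, hc₁, hc₂, ?_⟩, ?_⟩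
  · rw [hL, card_topSet a h0 hn]
    exact ⟨Nat.floor_le h0, Nat.lt_floor_add_one _⟩
  · congr
  · change Represents y ε _ (acceptMem n d R₇)
    have e₈ : ∀ b, b ≠ 14 → b ≠ 3 → acceptMem n d R₇ b = R₇ b := fun b hb hb' => by
      rw [acceptMem, overwrite_of_ne hb', overwrite_of_ne hb]
    refine ⟨fun i j => ?_, ?_, ?_, fun i => ?_⟩
    · rw [e₈ 0 (by decide) (by decide), hrep₇.points]
    · rw [e₈ 1 (by decide) (by decide), hrep₇.eps]
    · rw [e₈ 11 (by decide) (by decide), hrep₇.count]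
    · rw [acceptMem, overwrite_self i.2 one_pos, Finset.sum_range_one, overwrite_self i.2 one_pos,
        Finset.sum_range_one, hsum₇, hrep₇.eps, hrep₇.count, hu₇, hrep₇.weights, pick_eq_ite,
        Rat.cast_ofNat]
      split_ifs <;> rfl

theorem represents_initMem (y : Points n d) (ε : ℝ) :
    Represents y ε (fun _ => 1) (initMem n d (inputStore y ε).real) := by
  refine ⟨fun i j => ?_, ?_, ?_, fun i => ?_⟩
  · rw [initMem, overwrite_of_ne (by decide), overwrite_of_ne (by decide)]
    simp [inputStore]
  · rw [initMem, overwrite_of_ne (by decide), overwrite_of_ne (by decide)]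
    simp [inputStore]
  · rw [initMem, overwrite_of_ne (by decide), overwrite_self one_pos one_pos]
    simp
  · rw [initMem, overwrite_self i.2 one_pos]
    simp

/-- The program computes the weighted mean at the end of `n` steps of the filter. -/
theorem exists_filter_run (y : Points n d) (ε : ℝ) :
    ∃ W : ℕ → Fin n → ℝ, W 0 = (fun _ => 1) ∧
      (∀ k, IsFilterStep y (ε * n) (W k) (W (k + 1))) ∧
      ∀ j : Fin d, filterMem n d (inputStore y ε).real 2 0 j = wmean y (W n) j := by
  set R := initMem n d (inputStore y ε).real with hR
  -- The weights are read off the memory. The weights supplied by `Represents.stepMem` agree with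
  -- them, being determined by array `3`.
  let W : ℕ → Fin n → ℝ := fun k i => (stepMem n d)^[k] R 3 i 0
  have key : ∀ k, Represents y ε (W k) ((stepMem n d)^[k] R) := by
    intro k
    induction k with
    | zero =>
      have h := represents_initMem y ε
      exact ⟨h.points, h.eps, h.count, fun _ => rfl⟩
    | succ k ih =>
      rw [Function.iterate_succ_apply']
      obtain ⟨w', -, h⟩ := ih.stepMem
      refine ⟨h.points, h.eps, h.count, fun i => ?_⟩
      simp only [W, Function.iterate_succ_apply']
  refine ⟨W, ?_, fun k => ?_, fun j => ?_⟩
  · funext i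
    exact (represents_initMem y ε).weights i
  · obtain ⟨w', hstep, h⟩ := (key k).stepMem
    have : w' = W (k + 1) := by
      funext i
      rw [← h.weights i]
      simp only [W, Function.iterate_succ_apply']
    exact this ▸ hstep
  · exact (key n).meanMem.2 j

end RealRAM

/-! ### The estimator and its guarantee -/

/-- The estimator computed by the filter program. -/
noncomputable def filterEstimator : Estimator := fun n d y ε =>
  WithLp.toLp 2 fun j => RealRAM.filterMem n d (RealRAM.inputStore y ε).real 2 0 j

theorem filterEstimator_isPolyTime : filterEstimator.IsPolyTime := by
  obtain ⟨p, hp⟩ := RealRAM.computes_filterProg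
  refine ⟨RealRAM.filterProg, p, fun n d y ε => ?_⟩
  obtain ⟨t, s, hexec, ht, hreal, -⟩ := hp (RealRAM.inputStore y ε)
  refine ⟨t, s, hexec, ht, ?_⟩
  rw [RealRAM.outputVec, hreal]
  rfl

theorem mainTheorem7 :
    ∃ F : Estimator, F.IsPolyTime ∧
      ∃ C₀ K : ℝ, 0 < C₀ ∧ 0 < K ∧
        ∀ C : ℝ, C₀ ≤ C →
          ∀ (n d : ℕ) (S T : Points n d) (ε δ σ : ℝ), 0 < n → 0 < σ →
            IsCorruption ε S T →
            IsStable (C * ε) δ S (subMean S Finset.univ) σ →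
            ‖subMean S Finset.univ - F n d T ε‖ ≤ K * (σ * δ) := by
  -- C ≥ 1000 and Cε < 1/2 give ε ≤ 1/2000. The squared error is at most (448/C)(σδ)² when 1 ≤ εn,
  -- and zero otherwise, so K = 1 suffices.
  refine ⟨filterEstimator, filterEstimator_isPolyTime, 1000, 1, by norm_num, one_pos, ?_⟩
  intro C hC n d S T ε δ σ hn hσ hT hS
  obtain ⟨W, h0, hstep, hout⟩ := RealRAM.exists_filter_run T ε
  have hF : filterEstimator n d T ε = wmean T (W n) := by
    ext j
    exact hout j
  rw [hF, one_mul]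
  exact norm_subMean_sub_wmean_le hC hn hσ hT hS h0 hstep
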